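/- **Setting.** A manipulator has six revolute joints with angles $q$ (a point of the six-torus), forward kinematics $q\mapsto g(q)=(R(q),p(q))\in SE(3)$ of class $C^2$, symmetric positive definite inertia matrix $M(q)$ of class $C^1$, Coriolis matrix $C(q,\dot q)$ given by the Christoffel symbols of $M$, and gravity torque $G(q)$, and obeys $$M(q)\ddot q+C(q,\dot q)\dot q+G(q)=T,$$ without external force ($T_e=0$). Let $J(q)$ be the body Jacobian, so that $V^b=J\dot q=(v,\omega)$ is the body velocity of the end-effector ($\dot R=R\hat\omega$, $\dot p=Rv$). Where $J$ is invertible put $$\tilde M=J^{-T}MJ^{-1},\quad \tilde C=J^{-T}(C-MJ^{-1}\dot J)J^{-1},\quad \tilde G=J^{-T}G,\quad T=J^{T}\tilde T .$$ Let $g_d(t)=(R_d(t),p_d(t))\in SE(3)$, $t\ge 0$, be a desired trajectory with differentiable body velocity $V_d$. Put $g_{ed}=g^{-1}g_d$, $V_d^*=\mathrm{Ad}_{g_{ed}}V_d$, $e_V=V^b-V_d^*$, and let $\dot V_d^*$ be the time derivative of $V_d^*$ along the motion. For symmetric positive definite $K_p,K_R\in\mathbb R^{3\times 3}$ and $K_d\in\mathbb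 R^{6\times 6}$ consider the control law $$\tilde T=\tilde M\dot V_d^*+\tilde C V_d^*+\tilde G-f_g-K_de_V,\qquad f_g=\begin{bmatrix}R^TR_dK_pR_d^T(p-p_d)\\ (K_RR_d^TR-R^TR_dK_R)^\vee\end{bmatrix}.$$ A *motion* on a time interval is a twice differentiable $q(t)$ along which $J$ is invertible and the closed-loop equation holds. **Assumptions.** The desired trajectory is reachable, and uniformly away from singular configurations: there are a twice differentiable $q_d(t)$ with $g(q_d(t))=g_d(t)$ and a $\sigma>0$ with $|\det J(q_d(t))|\ge\sigma$ for all $t\ge0$. The desired velocity $V_d$ is bounded on $[0,\infty)$. **Theorem.** The equilibrium $g(t)=g_d(t)$ of the closed-loop system is asymptotically stable in the reachable set. In detail: 1. $q_d$ is a motion on $[0,\infty)$, and along it $g=g_d$, $e_V=0$ and $f_g=0$. 2. Let $E(t)$ be the sum of $\|q-q_d\|$, $\|R-R_d\|$, $\|p-p_d\|$ and $\|e_V\|$ at time $t$. For every $\varepsilon>0$ there is $\delta>0$ such that, for all $t_0\ge 0$ and $T>t_0$, every motion on $[t_0,T)$ with $E(t_0)<\delta$ has $E(t)<\varepsilon$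 for all $t\in[t_0,T)$. Moreover there is $\delta>0$ such that, for all $t_0\ge 0$, every motion on $[t_0,\infty)$ with $E(t_0)<\delta$ has $E(t)\to0$ as $t\to\infty$. 3. For every $\rho>0$, both parts of (2) also hold (with $\delta$ depending on $\rho$ too) with $\|R-R_d\|+\|p-p_d\|+\|e_V\|$ in place of $E$, among all motions along which $|\det J|\ge\rho$. -/

import Mathlib

open Set Filter Topology Matrix

namespace GeomImpedance

/-- Index of a six-vector: `Sum.inl` is the translational and `Sum.inr` the rotational part. -/
abbrev Six := Fin 3 ⊕ Fin 3

/-- The matrix of the cross product with `w`. -/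
def hat (w : Fin 3 → ℝ) : Matrix (Fin 3) (Fin 3) ℝ :=
  !![0, -w 2, w 1; w 2, 0, -w 0; -w 1, w 0, 0]

/-- Inverse of `hat` on skew-symmetric matrices. -/
def vee (A : Matrix (Fin 3) (Fin 3) ℝ) : Fin 3 → ℝ :=
  ![A 2 1, A 0 2, A 1 0]

/-- A rigid-body configuration `(R, p)`, to be read as `[R p; 0 1]`; that `R` is a rotation is
required wherever configurations are introduced. -/
structure Pose where
  R : Matrix (Fin 3) (Fin 3) ℝ
  p : Fin 3 → ℝ

/-- Partial derivative of a function of the joint angles. -/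
noncomputable def pderiv (i : Six) (f : (Six → ℝ) → ℝ) (q : Six → ℝ) : ℝ :=
  fderiv ℝ f q (Pi.single i 1)

/-- A manipulator with six revolute joints. Joint space is the six-torus, so its data are functions
of six angles that are `2π`-periodic in each of them: forward kinematics `fk` with values in
`SE(3)`, inertia matrix `M` and gravity torque `G`. -/
structure Manipulator where
  fk : (Six → ℝ) → Pose
  M : (Six → ℝ) → Matrix Six Six ℝ
  G : (Six → ℝ) → (Six → ℝ)
  rot : ∀ q, (fk q).R ∈ Matrix.specialOrthogonalGroup (Fin 3) ℝ
  smooth_R : ∀ i j, ContDiff ℝ 2 (fun q => (fk q).R i j)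
  smooth_p : ∀ i, ContDiff ℝ 2 (fun q => (fk q).p i)
  smooth_M : ∀ i j, ContDiff ℝ 1 (fun q => M q i j)
  posDef_M : ∀ q, (M q).PosDef
  periodic_fk : ∀ q i, fk (q + Pi.single i (2 * Real.pi)) = fk q
  periodic_M : ∀ q i, M (q + Pi.single i (2 * Real.pi)) = M q

namespace Manipulator

variable (rob : Manipulator)

/-- Body Jacobian: column `i` is the body velocity `(Rᵀ ∂ᵢp, (Rᵀ ∂ᵢR)^∨)`. -/
noncomputable def J (q : Six → ℝ) : Matrix Six Six ℝ :=
  Matrix.of fun a i =>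
    Sum.elim
      ((rob.fk q).Rᵀ *ᵥ fun b => pderiv i (fun x => (rob.fk x).p b) q)
      (vee ((rob.fk q).Rᵀ * Matrix.of fun b c => pderiv i (fun x => (rob.fk x).R b c) q)) a

/-- Time derivative of the body Jacobian when the joint velocity is `v`. -/
noncomputable def Jdot (q v : Six → ℝ) : Matrix Six Six ℝ :=
  Matrix.of fun a i => ∑ k, pderiv k (fun x => rob.J x a i) q * v k

/-- Coriolis matrix, by the Christoffel symbols of the inertia matrix. -/
noncomputable def C (q v : Six → ℝ) : Matrix Six Six ℝ :=
  Matrix.of fun i j => (1 / 2) * ∑ k,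
    (pderiv k (fun x => rob.M x i j) q + pderiv j (fun x => rob.M x i k) q
      - pderiv i (fun x => rob.M x k j) q) * v k

/-- Inertia matrix in end-effector coordinates. -/
noncomputable def Mt (q : Six → ℝ) : Matrix Six Six ℝ :=
  ((rob.J q)⁻¹)ᵀ * rob.M q * (rob.J q)⁻¹

/-- Coriolis matrix in end-effector coordinates. -/
noncomputable def Ct (q v : Six → ℝ) : Matrix Six Six ℝ :=
  ((rob.J q)⁻¹)ᵀ * (rob.C q v - rob.M q * (rob.J q)⁻¹ * rob.Jdot q v) * (rob.J q)⁻¹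

/-- Gravity force in end-effector coordinates. -/
noncomputable def Gt (q : Six → ℝ) : Six → ℝ :=
  ((rob.J q)⁻¹)ᵀ *ᵥ rob.G q

end Manipulator

/-- A desired trajectory `g(t)` in `SE(3)`, `t ≥ 0`, with body velocity `V(t)`, that is
`Ṙ = R ω̂` and `ṗ = R v` for `V = (v, ω)`; the velocity is differentiable. -/
structure DesiredTrajectory where
  g : ℝ → Pose
  V : ℝ → (Six → ℝ)
  rot : ∀ t, 0 ≤ t → (g t).R ∈ Matrix.specialOrthogonalGroup (Fin 3) ℝ
  deriv_R : ∀ t, 0 ≤ t → ∀ i j, HasDerivWithinAt (fun s => (g s).R i j)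
    (((g t).R * hat (fun k => V t (Sum.inr k))) i j) (Ici 0) t
  deriv_p : ∀ t, 0 ≤ t → HasDerivWithinAt (fun s => (g s).p)
    ((g t).R *ᵥ (fun k => V t (Sum.inl k))) (Ici 0) t
  diff_V : DifferentiableOn ℝ V (Ici 0)

/-- The adjoint map of `g⁻¹ gd`, with rotation `Rᵀ R_d` and translation `-Rᵀ (p - p_d)`. -/
def Ad (g gd : Pose) : Matrix Six Six ℝ :=
  Matrix.fromBlocks (g.Rᵀ * gd.R) (hat (-(g.Rᵀ *ᵥ (g.p - gd.p))) * (g.Rᵀ * gd.R))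
    0 (g.Rᵀ * gd.R)

/-- The desired velocity transported to `g`. -/
def VdStar (g gd : Pose) (Vd : Six → ℝ) : Six → ℝ := Ad g gd *ᵥ Vd

/-- The elastic force
`(Rᵀ R_d K_p R_dᵀ (p - p_d), (K_R R_dᵀ R - Rᵀ R_d K_R)^∨)`. -/
def elasticForce (Kp KR : Matrix (Fin 3) (Fin 3) ℝ) (g gd : Pose) : Six → ℝ :=
  Sum.elim ((g.Rᵀ * gd.R * Kp * gd.Rᵀ) *ᵥ (g.p - gd.p))
    (vee (KR * gd.Rᵀ * g.R - g.Rᵀ * gd.R * KR))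

/-- The velocity error `V^b - V_d^*` at time `t`, in the joint state `(q, v)`. -/
noncomputable def velError (rob : Manipulator) (des : DesiredTrajectory) (t : ℝ)
    (q v : Six → ℝ) : Six → ℝ :=
  rob.J q *ᵥ v - VdStar (rob.fk q) (des.g t) (des.V t)

/-- The control wrench
`M̃ V̇_d^* + C̃ V_d^* + G̃ - f_g - K_d e_V`, where `VdStarDot` stands for `V̇_d^*`. -/
noncomputable def controlWrench (rob : Manipulator) (des : DesiredTrajectory)
    (Kp KR : Matrix (Fin 3) (Fin 3) ℝ) (Kd : Matrix Six Six ℝ)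
    (t : ℝ) (q v VdStarDot : Six → ℝ) : Six → ℝ :=
  rob.Mt q *ᵥ VdStarDot + rob.Ct q v *ᵥ VdStar (rob.fk q) (des.g t) (des.V t) + rob.Gt q
    - elasticForce Kp KR (rob.fk q) (des.g t) - Kd *ᵥ velError rob des t q v

/-- `q` is a motion of the closed loop on the time interval `S`, with joint velocity `v` and joint
acceleration `a` and without external force: the body Jacobian stays invertible, and the equations
of motion `M q̈ + C q̇ + G = T` hold with joint torque `T = Jᵀ T̃`, where `T̃` is the control
wrench. -/
structure IsClosedLoopMotion (rob : Manipulator) (des : DesiredTrajectory)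
    (Kp KR : Matrix (Fin 3) (Fin 3) ℝ) (Kd : Matrix Six Six ℝ)
    (S : Set ℝ) (q v a : ℝ → (Six → ℝ)) : Prop where
  vel : ∀ t ∈ S, HasDerivWithinAt q (v t) S t
  acc : ∀ t ∈ S, HasDerivWithinAt v (a t) S t
  nonsingular : ∀ t ∈ S, (rob.J (q t)).det ≠ 0
  dynamics : ∀ t ∈ S,
    rob.M (q t) *ᵥ a t + rob.C (q t) (v t) *ᵥ v t + rob.G (q t) =
      (rob.J (q t))ᵀ *ᵥ controlWrench rob des Kp KR Kd t (q t) (v t)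
        (derivWithin (fun s => VdStar (rob.fk (q s)) (des.g s) (des.V s)) S t)

/-- The tracking error of the end-effector at time `t` in the joint state `(q, v)`: deviation of its
pose from the desired pose, plus the velocity error. It vanishes exactly if `g = g_d` and
`V^b = V_d^*`. -/
noncomputable def taskError (rob : Manipulator) (des : DesiredTrajectory)
    (t : ℝ) (q v : Six → ℝ) : ℝ :=
  ∑ i, ∑ j, |(rob.fk q).R i j - (des.g t).R i j| + ‖(rob.fk q).p - (des.g t).p‖
    + ‖velError rob des t q v‖

/-- The tracking error in the joint state space: the previous one plus the deviation of the joint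
angles from desired joint angles `qd`. -/
noncomputable def stateError (rob : Manipulator) (des : DesiredTrajectory)
    (qd : ℝ → (Six → ℝ)) (t : ℝ) (q v : Six → ℝ) : ℝ :=
  ‖q - qd t‖ + taskError rob des t q v

/-- Asymptotic stability of the state `err = 0` for the motions singled out by `Motion`, where
`Motion S q v` says that `q` is a motion on the time interval `S` with velocity `v`.
Stability: a motion on an interval `[t₀, T)`, `t₀ ≥ 0`, that starts with a small error keeps a
small error. Attractivity: the error of a motion on `[t₀, ∞)` that starts with an error below a
fixed bound tends to zero. -/
def AsymptoticallyStable (Motion : Set ℝ → (ℝ → (Six → ℝ)) → (ℝ → (Six → ℝ)) → Prop)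
    (err : ℝ → (Six → ℝ) → (Six → ℝ) → ℝ) : Prop :=
  (∀ ε : ℝ, 0 < ε → ∃ δ : ℝ, 0 < δ ∧ ∀ t₀ : ℝ, 0 ≤ t₀ → ∀ (T : ℝ) (q v : ℝ → (Six → ℝ)),
    Motion (Ico t₀ T) q v → err t₀ (q t₀) (v t₀) < δ →
      ∀ t ∈ Ico t₀ T, err t (q t) (v t) < ε) ∧
  (∃ δ : ℝ, 0 < δ ∧ ∀ t₀ : ℝ, 0 ≤ t₀ → ∀ q v : ℝ → (Six → ℝ),
    Motion (Ici t₀) q v → err t₀ (q t₀) (v t₀) < δ →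
      Tendsto (fun t => err t (q t) (v t)) atTop (𝓝 0))

end GeomImpedance

/-! The control law cancels gravity and the inertial and Coriolis terms of the transported desired
velocity. With `u = J⁻¹ e_V` the loop becomes `M u̇ + C u = -Jᵀ (f + K_d e_V)`, where `f` is the
elastic force (`IsClosedLoopMotion.hasDerivWithinAt_jointError`). The relative pose `(Q, r)` of
`g_d⁻¹ g` has body velocity `e_V`, and `f` is the gradient of the potential `½ r·K_p r + tr (K_R (1
- Q))`. Since the Christoffel symbols give `u·Ṁu = 2 u·Cu`, the energy `½ u·Mu` plus potential has
derivative `-e_V·K_d e_V`.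

On rotations the potential is exactly a positive definite quadratic form in `(1 - Q, r)`. The
manipulator data are periodic in the joint angles, so they range over a compact set as long as `|det
J| ≥ ρ`. Hence the energy is comparable to the squared task error, with constants independent of
time and joint angles (`exists_energy_bounds`), and monotonicity of the energy gives stability.

For attractivity, the dissipation sees only `e_V`, and the loop depends on time, so the invariance
principle for autonomous systems does not apply. Instead a small multiple of `f·e_V` is added to the
energy. Its derivative contains `-f·(J M⁻¹ Jᵀ f)`, which supplies the missing negative term. The
other terms are bounded because bounded `V_d` bounds the joint velocity. Near `Q = 1` the force
controls the relative pose (`exists_norm_le_force`), so the corrected energy decays exponentially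
(`tendsto_zero_of_cross_term`).

In joint space nothing is assumed about singularities along the motion. Forward kinematics is
injective on balls of a uniform radius around nonsingular points (`exists_uniform_local_bound`), so
a small task error keeps `q` close to `q_d`, which keeps `|det J| ≥ σ / 2`, which in turn keeps the
task error small; a continuity argument closes the circle (`exists_stateError_le`). -/

namespace GeomImpedance

/-! ### Homogeneous functions with parameters in a compact set -/

section Homogeneous

variable {X E G : Type*} [TopologicalSpace X] [NormedAddCommGroup E] [NormedSpace ℝ E]
  [FiniteDimensional ℝ E] [SeminormedAddCommGroup G]

/-- A continuous function is bounded on `K` times the unit sphere, and homogeneity carries the bound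
to all vectors. Nearly every constant below comes from this lemma or its lower-bound counterpart;
parameter-free forms use a one-point `K`. -/
theorem exists_norm_le_of_homogeneous {K : Set X} (hK : IsCompact K) (k : ℕ) (hk : k ≠ 0)
    (F : X → E → G) (hF : Continuous (Function.uncurry F))
    (hom : ∀ x (t : ℝ) w, ‖F x (t • w)‖ = |t| ^ k * ‖F x w‖) :
    ∃ c, 0 < c ∧ ∀ x ∈ K, ∀ w, ‖F x w‖ ≤ c * ‖w‖ ^ k := by
  have : ProperSpace E := FiniteDimensional.proper ℝ E
  have hc : IsCompact (K ×ˢ Metric.sphere (0 : E) 1) := hK.prod (isCompact_sphere 0 1)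
  obtain ⟨c, hc⟩ := (hc.image hF.norm).bddAbove
  refine ⟨max c 1, by positivity, fun x hx w => ?_⟩
  rcases eq_or_ne w 0 with rfl | hw
  · have := hom x 0 0
    simp [hk] at this
    simp [this, hk]
  · have hn : ‖w‖ ≠ 0 := norm_ne_zero_iff.2 hw
    have h1 : ‖F x (‖w‖⁻¹ • w)‖ ≤ c := hc ⟨(x, ‖w‖⁻¹ • w), ⟨hx, by simp [norm_smul, hn]⟩, rfl⟩
    have h2 := hom x ‖w‖ (‖w‖⁻¹ • w)
    rw [smul_smul, mul_inv_cancel₀ hn, one_smul, abs_of_nonneg (norm_nonneg _)] at h2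
    rw [h2, mul_comm]
    gcongr
    exact h1.trans (le_max_left _ _)

theorem exists_le_of_homogeneous {K : Set X} (hK : IsCompact K)
    (F : X → E → ℝ) (hF : Continuous (Function.uncurry F))
    (hom : ∀ x (t : ℝ) w, F x (t • w) = t ^ 2 * F x w)
    (pos : ∀ x ∈ K, ∀ w, w ≠ 0 → 0 < F x w) :
    ∃ c, 0 < c ∧ ∀ x ∈ K, ∀ w, c * ‖w‖ ^ 2 ≤ F x w := by
  have : ProperSpace E := FiniteDimensional.proper ℝ E
  have hcs : IsCompact (K ×ˢ Metric.sphere (0 : E) 1) := hK.prod (isCompact_sphere 0 1)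
  obtain ⟨c, hc0, hc⟩ : ∃ c, 0 < c ∧ ∀ z ∈ K ×ˢ Metric.sphere (0 : E) 1, c ≤ F z.1 z.2 := by
    rcases (K ×ˢ Metric.sphere (0 : E) 1).eq_empty_or_nonempty with h | h
    · exact ⟨1, one_pos, by simp [h]⟩
    · obtain ⟨z, hz, hm⟩ := hcs.exists_isMinOn h hF.continuousOn
      refine ⟨F z.1 z.2, pos _ hz.1 _ fun h0 => ?_, fun y hy => hm hy⟩
      have := hz.2
      simp [h0] at this
  refine ⟨c, hc0, fun x hx w => ?_⟩
  rcases eq_or_ne w 0 with rfl | hw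
  · have := hom x 0 0
    simp at this
    simp [this]
  · have hn : ‖w‖ ≠ 0 := norm_ne_zero_iff.2 hw
    have h1 := hc (x, ‖w‖⁻¹ • w) ⟨hx, by simp [norm_smul, hn]⟩
    have h2 := hom x ‖w‖ (‖w‖⁻¹ • w)
    rw [smul_smul, mul_inv_cancel₀ hn, one_smul] at h2
    rw [h2, mul_comm]
    gcongr

theorem exists_norm_le_of_smul [NormedSpace ℝ G] {K : Set X} (hK : IsCompact K)
    (F : X → E → G) (hF : Continuous (Function.uncurry F))
    (hom : ∀ x (t : ℝ) w, F x (t • w) = t • F x w) :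
    ∃ c, 0 < c ∧ ∀ x ∈ K, ∀ w, ‖F x w‖ ≤ c * ‖w‖ := by
  simpa using exists_norm_le_of_homogeneous hK 1 one_ne_zero F hF
    (fun x t w => by simp [hom, norm_smul])

end Homogeneous

/-! ### An exponential decay criterion -/

theorem antitoneOn_of_hasDerivWithinAt_nonpos {S : Set ℝ} (hS : S.OrdConnected) {f f' : ℝ → ℝ}
    (hf : ∀ t ∈ S, HasDerivWithinAt f (f' t) S t) (hf' : ∀ t ∈ S, f' t ≤ 0) : AntitoneOn f S := by
  refine antitoneOn_of_deriv_nonpos hS.convex (fun t ht => (hf t ht).continuousWithinAt)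
    (fun t ht => ((hf t (interior_subset ht)).mono interior_subset).differentiableWithinAt) ?_
  intro t ht
  have := (hf t (interior_subset ht)).hasDerivAt (mem_interior_iff_mem_nhds.1 ht)
  rw [this.deriv]
  exact hf' t (interior_subset ht)

/-- With the integrating factor `exp (γ t)` the function becomes nonincreasing. -/
theorem tendsto_zero_of_hasDerivWithinAt_le {t₀ γ : ℝ} (hγ : 0 < γ) {W W' : ℝ → ℝ}
    (hW : ∀ t ∈ Ici t₀, HasDerivWithinAt W (W' t) (Ici t₀) t)
    (hW' : ∀ t ∈ Ici t₀, W' t ≤ -γ * W t) (hpos : ∀ t ∈ Ici t₀, 0 ≤ W t) :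
    Tendsto W atTop (𝓝 0) := by
  have hanti : AntitoneOn (fun t => Real.exp (γ * t) * W t) (Ici t₀) := by
    refine antitoneOn_of_hasDerivWithinAt_nonpos ordConnected_Ici
      (f' := fun t => Real.exp (γ * t) * γ * W t + Real.exp (γ * t) * W' t) (fun t ht => ?_)
      (fun t ht => ?_)
    · have h1 : HasDerivWithinAt (fun t => Real.exp (γ * t)) (Real.exp (γ * t) * γ) (Ici t₀) t := by
        have := ((hasDerivAt_id t).const_mul γ).exp.hasDerivWithinAt (s := Ici t₀)
        simpa using this
      exact h1.mul (hW t ht)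
    · have := hW' t ht
      have h2 := Real.exp_pos (γ * t)
      nlinarith
  have hlim : Tendsto (fun t => Real.exp (γ * t₀) * W t₀ * Real.exp (-(γ * t))) atTop (𝓝 0) := by
    have h1 : Tendsto (fun t : ℝ => γ * t) atTop atTop := tendsto_id.const_mul_atTop hγ
    simpa using (Real.tendsto_exp_neg_atTop_nhds_zero.comp h1).const_mul (Real.exp (γ * t₀) * W t₀)
  refine squeeze_zero' (eventually_atTop.2 ⟨t₀, fun t ht => hpos t ht⟩)
    (eventually_atTop.2 ⟨t₀, fun t ht => ?_⟩) hlim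
  have h := hanti (mem_Ici.2 le_rfl) (mem_Ici.2 ht) ht
  simp only at h
  rw [Real.exp_neg, ← div_eq_mul_inv, le_div_iff₀ (Real.exp_pos _), mul_comm]
  exact h

/-- A weak Lyapunov function `V` whose derivative controls only `a` decays to zero if a cross term
`X` of lower order has a derivative that controls `b`. -/
theorem tendsto_zero_of_cross_term {t₀ k c ν c₁ c₂ : ℝ} (hk : 0 < k) (hc : 0 < c) (hν : 0 < ν)
    (hc₁ : 0 < c₁) (hc₂ : 0 < c₂) {V V' X X' a b : ℝ → ℝ}
    (hV : ∀ t ∈ Ici t₀, HasDerivWithinAt V (V' t) (Ici t₀) t)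
    (hX : ∀ t ∈ Ici t₀, HasDerivWithinAt X (X' t) (Ici t₀) t)
    (hV' : ∀ t ∈ Ici t₀, V' t ≤ -k * a t ^ 2)
    (hX' : ∀ t ∈ Ici t₀, X' t ≤ c * a t ^ 2 + c * (a t * b t) - ν * b t ^ 2)
    (hXV : ∀ t ∈ Ici t₀, |X t| ≤ c₁ * V t)
    (hVab : ∀ t ∈ Ici t₀, V t ≤ c₂ * (a t ^ 2 + b t ^ 2)) :
    Tendsto V atTop (𝓝 0) := by
  -- Splitting `c a b ≤ c² / (2ν) a² + (ν / 2) b²` leaves at most `D a² - (ν / 2) b²` for `X'`. The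
  -- first bound on `α` keeps `V + α X` between `V / 2` and `2 V`; the second lets half of the
  -- dissipation `k a²` absorb `α D a²`.
  set D : ℝ := c + c ^ 2 / (2 * ν) with hD
  have hDpos : 0 < D := by positivity
  set α : ℝ := min (1 / (2 * c₁)) (k / (2 * D)) with hα
  have hαpos : 0 < α := by positivity
  have hα1 : α * c₁ ≤ 1 / 2 := by
    have : α ≤ 1 / (2 * c₁) := min_le_left _ _
    calc α * c₁ ≤ 1 / (2 * c₁) * c₁ := by gcongr
      _ = 1 / 2 := by field_simp
  have hα2 : α * D ≤ k / 2 := by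
    have : α ≤ k / (2 * D) := min_le_right _ _
    calc α * D ≤ k / (2 * D) * D := by gcongr
      _ = k / 2 := by field_simp
  set g : ℝ := min (k / 2) (α * ν / 2) with hg
  have hgpos : 0 < g := by positivity
  have hV0 : ∀ t ∈ Ici t₀, 0 ≤ V t := fun t ht => by
    have := (abs_nonneg _).trans (hXV t ht)
    exact nonneg_of_mul_nonneg_right this hc₁
  have hlo : ∀ t ∈ Ici t₀, V t / 2 ≤ V t + α * X t := fun t ht => by
    have h1 := (abs_le.1 (hXV t ht)).1
    have h2 := hV0 t ht
    nlinarith [mul_le_mul_of_nonneg_left h1 hαpos.le]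
  have hup : ∀ t ∈ Ici t₀, V t + α * X t ≤ 2 * V t := fun t ht => by
    have h1 := (abs_le.1 (hXV t ht)).2
    have h2 := hV0 t ht
    nlinarith [mul_le_mul_of_nonneg_left h1 hαpos.le]
  have hmain : Tendsto (fun t => V t + α * X t) atTop (𝓝 0) := by
    refine tendsto_zero_of_hasDerivWithinAt_le (γ := g / (2 * c₂)) (by positivity)
      (fun t ht => (hV t ht).add ((hX t ht).const_mul α)) (fun t ht => ?_)
      (fun t ht => (by linarith [hV0 t ht, hlo t ht]))
    have hab : c * (a t * b t) ≤ c ^ 2 / (2 * ν) * a t ^ 2 + ν / 2 * b t ^ 2 := by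
      have : c ^ 2 / (2 * ν) * a t ^ 2 + ν / 2 * b t ^ 2 - c * (a t * b t)
          = (c * a t - ν * b t) ^ 2 / (2 * ν) := by field_simp; ring
      have h2 : 0 ≤ (c * a t - ν * b t) ^ 2 / (2 * ν) := by positivity
      linarith
    have h1 : X' t ≤ D * a t ^ 2 - ν / 2 * b t ^ 2 := by
      rw [hD]; linarith [hX' t ht]
    have h2 : V' t + α * X' t ≤ -g * (a t ^ 2 + b t ^ 2) := by
      have e1 := mul_le_mul_of_nonneg_left h1 hαpos.le
      have e2 := mul_le_mul_of_nonneg_right hα2 (sq_nonneg (a t))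
      have e3 := mul_le_mul_of_nonneg_right (min_le_left (k / 2) (α * ν / 2)) (sq_nonneg (a t))
      have e4 := mul_le_mul_of_nonneg_right (min_le_right (k / 2) (α * ν / 2)) (sq_nonneg (b t))
      rw [← hg] at e3 e4
      linarith [hV' t ht]
    have h3 : g / (2 * c₂) * (V t + α * X t) ≤ g * (a t ^ 2 + b t ^ 2) := by
      calc g / (2 * c₂) * (V t + α * X t) ≤ g / (2 * c₂) * (2 * (c₂ * (a t ^ 2 + b t ^ 2))) := by
            gcongr
            linarith [hup t ht, hVab t ht]
        _ = g * (a t ^ 2 + b t ^ 2) := by field_simp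
    linarith
  refine squeeze_zero' (eventually_atTop.2 ⟨t₀, hV0⟩)
    (eventually_atTop.2 ⟨t₀, fun t ht => ?_⟩) (by simpa using hmain.const_mul 2)
  linarith [hlo t ht]

/-! ### Entrywise derivatives of matrix-valued curves -/

section MatrixCalculus

variable {l m n : Type*}

/-- `A'` is the entrywise derivative of the matrix-valued curve `A` at `t` within `S`. -/
def MatHasDerivWithinAt (A : ℝ → Matrix l m ℝ) (A' : Matrix l m ℝ) (S : Set ℝ) (t : ℝ) : Prop :=
  ∀ i j, HasDerivWithinAt (fun s => A s i j) (A' i j) S t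

variable {S : Set ℝ} {t : ℝ}

theorem MatHasDerivWithinAt.const (A : Matrix l m ℝ) :
    MatHasDerivWithinAt (fun _ => A) 0 S t := fun _ _ => by
  simpa using hasDerivWithinAt_const _ _ _

theorem MatHasDerivWithinAt.transpose {A : ℝ → Matrix l m ℝ} {A' : Matrix l m ℝ}
    (hA : MatHasDerivWithinAt A A' S t) : MatHasDerivWithinAt (fun s => (A s)ᵀ) A'ᵀ S t :=
  fun i j => hA j i

theorem MatHasDerivWithinAt.sub {A B : ℝ → Matrix l m ℝ} {A' B' : Matrix l m ℝ}
    (hA : MatHasDerivWithinAt A A' S t) (hB : MatHasDerivWithinAt B B' S t) :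
    MatHasDerivWithinAt (fun s => A s - B s) (A' - B') S t :=
  fun i j => (hA i j).sub (hB i j)

theorem MatHasDerivWithinAt.mul [Fintype m] {A : ℝ → Matrix l m ℝ} {A' : Matrix l m ℝ}
    {B : ℝ → Matrix m n ℝ} {B' : Matrix m n ℝ} (hA : MatHasDerivWithinAt A A' S t)
    (hB : MatHasDerivWithinAt B B' S t) :
    MatHasDerivWithinAt (fun s => A s * B s) (A' * B t + A t * B') S t := fun i j => by
  simp only [Matrix.mul_apply, Matrix.add_apply, ← Finset.sum_add_distrib]
  exact HasDerivWithinAt.fun_sum fun k _ => (hA i k).mul (hB k j)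

theorem MatHasDerivWithinAt.mulVec [Fintype l] [Fintype m] {A : ℝ → Matrix l m ℝ} {A' : Matrix l m ℝ}
    {x : ℝ → m → ℝ} {x' : m → ℝ} (hA : MatHasDerivWithinAt A A' S t)
    (hx : HasDerivWithinAt x x' S t) :
    HasDerivWithinAt (fun s => A s *ᵥ x s) (A' *ᵥ x t + A t *ᵥ x') S t := by
  rw [hasDerivWithinAt_pi] at hx ⊢
  intro i
  simp only [Matrix.mulVec, dotProduct, Pi.add_apply, ← Finset.sum_add_distrib]
  exact HasDerivWithinAt.fun_sum fun k _ => (hA i k).mul (hx k)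

theorem hasDerivWithinAt_dotProduct [Fintype m] {x y : ℝ → m → ℝ} {x' y' : m → ℝ}
    (hx : HasDerivWithinAt x x' S t) (hy : HasDerivWithinAt y y' S t) :
    HasDerivWithinAt (fun s => x s ⬝ᵥ y s) (x' ⬝ᵥ y t + x t ⬝ᵥ y') S t := by
  rw [hasDerivWithinAt_pi] at hx hy
  simp only [dotProduct, ← Finset.sum_add_distrib]
  exact HasDerivWithinAt.fun_sum fun k _ => (hx k).mul (hy k)

theorem MatHasDerivWithinAt.trace [Fintype m] {A : ℝ → Matrix m m ℝ} {A' : Matrix m m ℝ}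
    (hA : MatHasDerivWithinAt A A' S t) :
    HasDerivWithinAt (fun s => (A s).trace) A'.trace S t :=
  HasDerivWithinAt.fun_sum fun k _ => hA k k

/-- By Cramer's rule the entries are quotients of polynomials in those of `A`. No formula for the
derivative is needed, since it is later recovered by uniqueness. -/
theorem MatHasDerivWithinAt.differentiableWithinAt_inv [Fintype m] [DecidableEq m] {A : ℝ → Matrix m m ℝ}
    {A' : Matrix m m ℝ} (hA : MatHasDerivWithinAt A A' S t) (hdet : (A t).det ≠ 0) (i j : m) :
    DifferentiableWithinAt ℝ (fun s => (A s)⁻¹ i j) S t := by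
  have key : ∀ B : ℝ → Matrix m m ℝ, (∀ i j, DifferentiableWithinAt ℝ (fun s => B s i j) S t) →
      DifferentiableWithinAt ℝ (fun s => (B s).det) S t := fun B hB => by
    simp only [Matrix.det_apply]
    refine DifferentiableWithinAt.fun_sum fun σ _ => ?_
    refine DifferentiableWithinAt.const_smul ?_ _
    exact DifferentiableWithinAt.fun_finsetProd fun k _ => hB _ _
  have hA' : ∀ i j, DifferentiableWithinAt ℝ (fun s => A s i j) S t :=
    fun i j => (hA i j).differentiableWithinAt
  simp only [Matrix.inv_def, Ring.inverse_eq_inv', Matrix.smul_apply, Matrix.adjugate_apply,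
    smul_eq_mul]
  refine ((key A hA').inv hdet).mul (key _ fun a b => ?_)
  by_cases h : a = j
  · subst h; simp [differentiableWithinAt_const]
  · simpa [Matrix.updateRow_ne h] using hA' a b

end MatrixCalculus

/-! ### Skew-symmetric matrices and rotations -/

theorem hat_vee {A : Matrix (Fin 3) (Fin 3) ℝ} (hA : Aᵀ = -A) : hat (vee A) = A := by
  have h : ∀ i j, A j i = -A i j := fun i j => congrFun (congrFun hA i) j
  have h0 := h 0 0
  have h1 := h 1 1
  have h2 := h 2 2
  ext i j
  fin_cases i <;> fin_cases j <;> simp [hat, vee] <;> linarith [h 0 1, h 0 2, h 1 2]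

theorem vee_hat (w : Fin 3 → ℝ) : vee (hat w) = w := by
  ext i; fin_cases i <;> simp [hat, vee]

theorem hat_transpose (w : Fin 3 → ℝ) : (hat w)ᵀ = -hat w := by
  ext i j; fin_cases i <;> fin_cases j <;> simp [hat]

theorem transpose_mul_self_of_mem {R : Matrix (Fin 3) (Fin 3) ℝ}
    (hR : R ∈ Matrix.specialOrthogonalGroup (Fin 3) ℝ) : Rᵀ * R = 1 :=
  (Matrix.mem_orthogonalGroup_iff' (Fin 3) ℝ).1 (Matrix.mem_specialOrthogonalGroup_iff.1 hR).1

theorem mul_transpose_self_of_mem {R : Matrix (Fin 3) (Fin 3) ℝ}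
    (hR : R ∈ Matrix.specialOrthogonalGroup (Fin 3) ℝ) : R * Rᵀ = 1 :=
  (Matrix.mem_orthogonalGroup_iff (Fin 3) ℝ).1 (Matrix.mem_specialOrthogonalGroup_iff.1 hR).1

theorem MatHasDerivWithinAt.transpose_mul_skew {R : ℝ → Matrix (Fin 3) (Fin 3) ℝ}
    {R' : Matrix (Fin 3) (Fin 3) ℝ} {S : Set ℝ} {t : ℝ} (hR : MatHasDerivWithinAt R R' S t)
    (h1 : ∀ s ∈ S, (R s)ᵀ * R s = 1) (ht : t ∈ S) (hu : UniqueDiffWithinAt ℝ S t) :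
    ((R t)ᵀ * R')ᵀ = -((R t)ᵀ * R') := by
  have h := hR.transpose.mul hR
  have h0 : R'ᵀ * R t + (R t)ᵀ * R' = 0 := by
    ext i j
    have e : HasDerivWithinAt (fun s => ((R s)ᵀ * R s) i j) 0 S t :=
      (hasDerivWithinAt_const t S ((1 : Matrix (Fin 3) (Fin 3) ℝ) i j)).congr
        (fun s hs => by rw [h1 s hs]) (by rw [h1 t ht])
    exact hu.eq_deriv _ (h i j) e
  rw [Matrix.transpose_mul, Matrix.transpose_transpose]
  exact eq_neg_of_add_eq_zero_left h0

/-! ### Kinematics -/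

theorem fderiv_eq_sum_pderiv (f : (Six → ℝ) → ℝ) (q w : Six → ℝ) :
    fderiv ℝ f q w = ∑ k, pderiv k f q * w k := by
  conv_lhs => rw [pi_eq_sum_univ' w, map_sum]
  refine Finset.sum_congr rfl fun k _ => ?_
  rw [map_smul, smul_eq_mul, mul_comm]
  congr 2

theorem hasDerivWithinAt_comp_pderiv {f : (Six → ℝ) → ℝ} {q : ℝ → Six → ℝ} {v : Six → ℝ}
    {S : Set ℝ} {t : ℝ} (hf : DifferentiableAt ℝ f (q t)) (hq : HasDerivWithinAt q v S t) :
    HasDerivWithinAt (fun s => f (q s)) (∑ k, pderiv k f (q t) * v k) S t := by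
  rw [← fderiv_eq_sum_pderiv]
  exact hf.hasFDerivAt.comp_hasDerivWithinAt t hq

theorem contDiff_pderiv {f : (Six → ℝ) → ℝ} {n : WithTop ℕ∞} (hf : ContDiff ℝ (n + 1) f) (k : Six) :
    ContDiff ℝ n (pderiv k f) :=
  (hf.fderiv_right le_rfl).clm_apply contDiff_const

namespace Manipulator

variable (rob : Manipulator)

/-- Directional derivative of the end-effector rotation. -/
noncomputable def rotDeriv (q w : Six → ℝ) : Matrix (Fin 3) (Fin 3) ℝ :=
  Matrix.of fun b c => ∑ k, pderiv k (fun x => (rob.fk x).R b c) q * w k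

/-- Directional derivative of the end-effector position. -/
noncomputable def posDeriv (q w : Six → ℝ) : Fin 3 → ℝ :=
  fun b => ∑ k, pderiv k (fun x => (rob.fk x).p b) q * w k

/-- Directional derivative of the inertia matrix. -/
noncomputable def inertiaDeriv (q w : Six → ℝ) : Matrix Six Six ℝ :=
  Matrix.of fun i j => ∑ k, pderiv k (fun x => rob.M x i j) q * w k

theorem J_mulVec (q w : Six → ℝ) : rob.J q *ᵥ w =
    Sum.elim ((rob.fk q).Rᵀ *ᵥ rob.posDeriv q w) (vee ((rob.fk q).Rᵀ * rob.rotDeriv q w)) := by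
  ext a
  rcases a with a | a
  · simp only [Matrix.mulVec, dotProduct, J, Matrix.of_apply, Sum.elim_inl, posDeriv,
      Finset.sum_mul, Finset.mul_sum]
    rw [Finset.sum_comm]
    simp only [mul_assoc]
  · have : ∀ b c, ((rob.fk q).Rᵀ * rob.rotDeriv q w) b c = ∑ i,
        ((rob.fk q).Rᵀ * Matrix.of fun b c => pderiv i (fun x => (rob.fk x).R b c) q) b c * w i := by
      intro b c
      simp only [Matrix.mul_apply, rotDeriv, Matrix.of_apply, Finset.sum_mul, Finset.mul_sum]
      rw [Finset.sum_comm]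
      simp only [mul_assoc]
    simp only [Matrix.mulVec, dotProduct, J, Matrix.of_apply, Sum.elim_inr]
    fin_cases a <;> simp [vee, this]

theorem differentiable_R (i j : Fin 3) : Differentiable ℝ fun q => (rob.fk q).R i j :=
  (rob.smooth_R i j).differentiable two_ne_zero

theorem differentiable_p (i : Fin 3) : Differentiable ℝ fun q => (rob.fk q).p i :=
  (rob.smooth_p i).differentiable two_ne_zero

theorem differentiable_M (i j : Six) : Differentiable ℝ fun q => rob.M q i j :=
  (rob.smooth_M i j).differentiable one_ne_zero

theorem contDiff_J (i j : Six) : ContDiff ℝ 1 fun q => rob.J q i j := by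
  have hR : ∀ a b, ContDiff ℝ 1 fun q => (rob.fk q).R a b :=
    fun a b => (rob.smooth_R a b).of_le one_le_two
  have hR' : ∀ a b k, ContDiff ℝ 1 (pderiv k fun q => (rob.fk q).R a b) :=
    fun a b => contDiff_pderiv (by simpa [one_add_one_eq_two] using rob.smooth_R a b)
  have hp' : ∀ a k, ContDiff ℝ 1 (pderiv k fun q => (rob.fk q).p a) :=
    fun a => contDiff_pderiv (by simpa [one_add_one_eq_two] using rob.smooth_p a)
  rcases i with i | i
  · simp only [J, Matrix.of_apply, Sum.elim_inl, Matrix.mulVec, dotProduct, Matrix.transpose_apply]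
    exact ContDiff.sum fun k _ => (hR _ _).mul (hp' _ _)
  · fin_cases i <;>
    · simp [J, vee, Matrix.mul_apply]
      exact ContDiff.sum fun k _ => (hR _ _).mul (hR' _ _ _)

section Curve

variable {q : ℝ → Six → ℝ} {v : Six → ℝ} {S : Set ℝ} {t : ℝ}

theorem matHasDerivWithinAt_R (hq : HasDerivWithinAt q v S t) :
    MatHasDerivWithinAt (fun s => (rob.fk (q s)).R) (rob.rotDeriv (q t) v) S t :=
  fun i j => hasDerivWithinAt_comp_pderiv (rob.differentiable_R i j _) hq

theorem hasDerivWithinAt_p (hq : HasDerivWithinAt q v S t) :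
    HasDerivWithinAt (fun s => (rob.fk (q s)).p) (rob.posDeriv (q t) v) S t :=
  hasDerivWithinAt_pi.2 fun i => hasDerivWithinAt_comp_pderiv (rob.differentiable_p i _) hq

theorem matHasDerivWithinAt_M (hq : HasDerivWithinAt q v S t) :
    MatHasDerivWithinAt (fun s => rob.M (q s)) (rob.inertiaDeriv (q t) v) S t :=
  fun i j => hasDerivWithinAt_comp_pderiv (rob.differentiable_M i j _) hq

theorem matHasDerivWithinAt_J (hq : HasDerivWithinAt q v S t) :
    MatHasDerivWithinAt (fun s => rob.J (q s)) (rob.Jdot (q t) v) S t :=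
  fun i j => hasDerivWithinAt_comp_pderiv
    ((rob.contDiff_J i j).differentiable one_ne_zero _) hq

end Curve

/-- Along the straight line `q + s w` the rotation stays orthogonal, so `Rᵀ Ṙ` is skew-symmetric and
`hat` undoes the `vee` in the Jacobian. -/
theorem rotDeriv_eq (q w : Six → ℝ) : rob.rotDeriv q w =
    (rob.fk q).R * hat (fun k => (rob.J q *ᵥ w) (Sum.inr k)) := by
  have hline : HasDerivWithinAt (fun s : ℝ => q + s • w) w univ 0 := by
    have := ((hasDerivAt_id (0 : ℝ)).smul_const w).const_add q
    simpa using this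
  have h := (rob.matHasDerivWithinAt_R hline).transpose_mul_skew
    (fun s _ => transpose_mul_self_of_mem (rob.rot _)) (mem_univ _) uniqueDiffWithinAt_univ
  simp only [zero_smul, add_zero] at h
  rw [rob.J_mulVec]
  simp only [Sum.elim_inr]
  rw [hat_vee h, ← mul_assoc, mul_transpose_self_of_mem (rob.rot q), one_mul]

theorem posDeriv_eq (q w : Six → ℝ) : rob.posDeriv q w =
    (rob.fk q).R *ᵥ (fun k => (rob.J q *ᵥ w) (Sum.inl k)) := by
  rw [rob.J_mulVec]
  simp only [Sum.elim_inl]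
  rw [Matrix.mulVec_mulVec, mul_transpose_self_of_mem (rob.rot q), Matrix.one_mulVec]

/-- This is the skew-symmetry of `Ṁ - 2C` tested on a vector. Of the three Christoffel terms, the
last two cancel in the quadratic form after exchanging `i` and `j`, because `M` is symmetric. -/
theorem dotProduct_C_mulVec (q v u : Six → ℝ) :
    u ⬝ᵥ (rob.C q v *ᵥ u) = (1 / 2) * (u ⬝ᵥ (rob.inertiaDeriv q v *ᵥ u)) := by
  have hs : ∀ i j, (fun x => rob.M x i j) = fun x => rob.M x j i := fun i j => by
    ext x
    simpa using congrFun (congrFun (rob.posDef_M x).isHermitian j) i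
  have e1 : u ⬝ᵥ (rob.C q v *ᵥ u) = (1 / 2) * (u ⬝ᵥ (rob.inertiaDeriv q v *ᵥ u)) +
      (1 / 2) * ((∑ i, ∑ j, ∑ k, pderiv j (fun x => rob.M x i k) q * v k * u i * u j)
        - ∑ i, ∑ j, ∑ k, pderiv i (fun x => rob.M x k j) q * v k * u i * u j) := by
    simp only [dotProduct, Matrix.mulVec, C, inertiaDeriv, Matrix.of_apply, Finset.mul_sum,
      Finset.sum_mul, ← Finset.sum_add_distrib, ← Finset.sum_sub_distrib]
    refine Finset.sum_congr rfl fun i _ => Finset.sum_congr rfl fun j _ =>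
      Finset.sum_congr rfl fun k _ => ?_
    ring
  rw [e1, add_eq_left, Finset.sum_comm]
  rw [mul_eq_zero, sub_eq_zero]
  right
  refine Finset.sum_congr rfl fun i _ => Finset.sum_congr rfl fun j _ =>
      Finset.sum_congr rfl fun k _ => ?_
  rw [hs j k]
  ring

end Manipulator

/-! ### Relative pose and the closed-loop error dynamics -/

theorem MatHasDerivWithinAt.hat {w : ℝ → Fin 3 → ℝ} {w' : Fin 3 → ℝ} {S : Set ℝ} {t : ℝ}
    (hw : HasDerivWithinAt w w' S t) :
    MatHasDerivWithinAt (fun s => hat (w s)) (hat w') S t := by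
  have h := hasDerivWithinAt_pi.1 hw
  intro i j
  fin_cases i <;> fin_cases j <;> simp [GeomImpedance.hat] <;>
    first | exact h _ | exact (h _).neg | exact hasDerivWithinAt_const _ _ _

theorem MatHasDerivWithinAt.fromBlocks {l m n o : Type*} {A : ℝ → Matrix n l ℝ}
    {B : ℝ → Matrix n m ℝ} {C : ℝ → Matrix o l ℝ} {D : ℝ → Matrix o m ℝ} {A' : Matrix n l ℝ}
    {B' : Matrix n m ℝ} {C' : Matrix o l ℝ} {D' : Matrix o m ℝ} {S : Set ℝ} {t : ℝ}
    (hA : MatHasDerivWithinAt A A' S t) (hB : MatHasDerivWithinAt B B' S t)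
    (hC : MatHasDerivWithinAt C C' S t) (hD : MatHasDerivWithinAt D D' S t) :
    MatHasDerivWithinAt (fun s => Matrix.fromBlocks (A s) (B s) (C s) (D s))
      (Matrix.fromBlocks A' B' C' D') S t := by
  rintro (i | i) (j | j)
  · exact hA i j
  · exact hB i j
  · exact hC i j
  · exact hD i j

/-- As a bilinear form, `hat x` is a triple product with one slot fixed, and applying `A` to all
three slots multiplies the triple product by `det A`. For rotations this is the equivariance of the
cross product. -/
theorem transpose_mul_hat_mulVec_mul (A : Matrix (Fin 3) (Fin 3) ℝ) (x : Fin 3 → ℝ) :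
    Aᵀ * hat (A *ᵥ x) * A = A.det • hat x := by
  ext i j
  fin_cases i <;> fin_cases j <;>
    simp [hat, Matrix.mul_apply, Matrix.mulVec, dotProduct, Fin.sum_univ_three,
      Matrix.det_fin_three] <;> ring

theorem hat_mulVec_comm (x y : Fin 3 → ℝ) : hat x *ᵥ y = -(hat y *ᵥ x) := by
  ext i
  fin_cases i <;> simp [hat, Matrix.mulVec, dotProduct, Fin.sum_univ_three] <;> ring

theorem hat_neg (x : Fin 3 → ℝ) : hat (-x) = -hat x := by
  ext i j
  fin_cases i <;> fin_cases j <;> simp [hat]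

/-- Only the skew part of `A` pairs with `hat w`. This identifies the gradient of the rotational
potential. -/
theorem trace_mul_hat (A : Matrix (Fin 3) (Fin 3) ℝ) (w : Fin 3 → ℝ) :
    (A * hat w).trace = -(w ⬝ᵥ vee (A - Aᵀ)) := by
  simp [hat, vee, Matrix.trace, Matrix.mul_apply, dotProduct, Fin.sum_univ_three]
  ring

/-- Rotation of `gd⁻¹ g`. -/
def relRot (g gd : Pose) : Matrix (Fin 3) (Fin 3) ℝ := gd.Rᵀ * g.R

/-- Translation of `gd⁻¹ g`. -/
def relPos (g gd : Pose) : Fin 3 → ℝ := gd.Rᵀ *ᵥ (g.p - gd.p)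

/-- The elastic force in terms of the relative pose. -/
def force (Kp KR Q : Matrix (Fin 3) (Fin 3) ℝ) (r : Fin 3 → ℝ) : Six → ℝ :=
  Sum.elim (Qᵀ *ᵥ (Kp *ᵥ r)) (vee (KR * Q - Qᵀ * KR))

/-- The adjoint matrix in terms of the relative pose. -/
def relAd (Q : Matrix (Fin 3) (Fin 3) ℝ) (r : Fin 3 → ℝ) : Matrix Six Six ℝ :=
  Matrix.fromBlocks Qᵀ (hat (-(Qᵀ *ᵥ r)) * Qᵀ) 0 Qᵀ

/-- The elastic potential. -/
noncomputable def potential (Kp KR Q : Matrix (Fin 3) (Fin 3) ℝ) (r : Fin 3 → ℝ) : ℝ :=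
  (1 / 2) * (r ⬝ᵥ (Kp *ᵥ r)) + (KR * (1 - Q)).trace

theorem elasticForce_eq (Kp KR : Matrix (Fin 3) (Fin 3) ℝ) (g gd : Pose) :
    elasticForce Kp KR g gd = force Kp KR (relRot g gd) (relPos g gd) := by
  simp only [elasticForce, force, relRot, relPos, Matrix.transpose_mul, Matrix.transpose_transpose,
    Matrix.mulVec_mulVec, mul_assoc]

theorem Ad_eq {g gd : Pose} (hgd : gd.R ∈ Matrix.specialOrthogonalGroup (Fin 3) ℝ) :
    Ad g gd = relAd (relRot g gd) (relPos g gd) := by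
  have h := mul_transpose_self_of_mem hgd
  have e : (g.Rᵀ * gd.R) *ᵥ (gd.Rᵀ *ᵥ (g.p - gd.p)) = g.Rᵀ *ᵥ (g.p - gd.p) := by
    rw [Matrix.mulVec_mulVec, mul_assoc, h, mul_one]
  simp only [Ad, relAd, relRot, relPos, Matrix.transpose_mul, Matrix.transpose_transpose, e]

theorem relRot_mem {g gd : Pose} (hg : g.R ∈ Matrix.specialOrthogonalGroup (Fin 3) ℝ)
    (hgd : gd.R ∈ Matrix.specialOrthogonalGroup (Fin 3) ℝ) :
    relRot g gd ∈ Matrix.specialOrthogonalGroup (Fin 3) ℝ := by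
  rw [Matrix.mem_specialOrthogonalGroup_iff] at *
  refine ⟨?_, by simp [relRot, hg.2, hgd.2]⟩
  rw [Matrix.mem_orthogonalGroup_iff']
  have h1 := (Matrix.mem_orthogonalGroup_iff' (Fin 3) ℝ).1 hg.1
  have h2 := (Matrix.mem_orthogonalGroup_iff (Fin 3) ℝ).1 hgd.1
  change (gd.Rᵀ * g.R)ᵀ * (gd.Rᵀ * g.R) = 1
  change gd.R * gd.Rᵀ = 1 at h2
  change g.Rᵀ * g.R = 1 at h1
  rw [Matrix.transpose_mul, Matrix.transpose_transpose, mul_assoc, ← mul_assoc gd.R, h2, one_mul,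
    h1]

theorem mul_hat_transpose_mulVec {Q : Matrix (Fin 3) (Fin 3) ℝ}
    (hQ : Q ∈ Matrix.specialOrthogonalGroup (Fin 3) ℝ) (x : Fin 3 → ℝ) :
    Q * hat (Qᵀ *ᵥ x) * Qᵀ = hat x := by
  have h := transpose_mul_hat_mulVec_mul Qᵀ x
  rwa [Matrix.transpose_transpose, Matrix.det_transpose,
    (Matrix.mem_specialOrthogonalGroup_iff.1 hQ).2, one_smul] at h

section RelativePose

variable {g gd : ℝ → Pose} {V Vd : Six → ℝ} {S : Set ℝ} {t : ℝ}

/-- The product rule gives `Q ŵ - ŵ_d Q`, and `ŵ_d Q = Q hat (Qᵀ w_d)` moves the desired angular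
velocity into the body frame. The transport in `VdStar` is exactly what makes the velocity error
drive the relative pose. -/
theorem matHasDerivWithinAt_relRot
    (hg : (g t).R ∈ Matrix.specialOrthogonalGroup (Fin 3) ℝ)
    (hgd : (gd t).R ∈ Matrix.specialOrthogonalGroup (Fin 3) ℝ)
    (hR : MatHasDerivWithinAt (fun s => (g s).R) ((g t).R * hat (fun k => V (Sum.inr k))) S t)
    (hRd : MatHasDerivWithinAt (fun s => (gd s).R) ((gd t).R * hat (fun k => Vd (Sum.inr k))) S t) :
    MatHasDerivWithinAt (fun s => relRot (g s) (gd s)) (relRot (g t) (gd t) *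
      hat (fun k => (V - VdStar (g t) (gd t) Vd) (Sum.inr k))) S t := by
  have h := hRd.transpose.mul hR
  have hQ := relRot_mem hg hgd
  set Q := relRot (g t) (gd t) with hQdef
  set w : Fin 3 → ℝ := fun k => V (Sum.inr k)
  set wd : Fin 3 → ℝ := fun k => Vd (Sum.inr k)
  have e1 : (fun k => (V - VdStar (g t) (gd t) Vd) (Sum.inr k)) = w - Qᵀ *ᵥ wd := by
    ext k
    simp only [VdStar, Ad_eq hgd, relAd, ← hQdef, Matrix.fromBlocks_mulVec, Pi.sub_apply,
      Sum.elim_inr, Matrix.zero_mulVec, zero_add, w, wd]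
    rfl
  have e2 : hat (w - Qᵀ *ᵥ wd) = hat w - hat (Qᵀ *ᵥ wd) := by
    ext i j
    fin_cases i <;> fin_cases j <;> simp [hat] <;> ring
  have e3 : Q * hat (Qᵀ *ᵥ wd) = hat wd * Q := by
    rw [← mul_hat_transpose_mulVec hQ wd, mul_assoc _ Qᵀ Q, transpose_mul_self_of_mem hQ, mul_one]
  rw [e1, e2, mul_sub, e3]
  refine (fun i j => (h i j).congr_deriv (congrFun (congrFun ?_ i) j))
  rw [Matrix.transpose_mul, hat_transpose, mul_assoc, neg_mul, ← mul_assoc (gd t).Rᵀ]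
  change -(hat wd * Q) + Q * hat w = Q * hat w - hat wd * Q
  abel

/-- The off-diagonal block of the adjoint contributes the term `-ŵ_d r` that comes from
differentiating `R_dᵀ`. -/
theorem hasDerivWithinAt_relPos
    (hg : (g t).R ∈ Matrix.specialOrthogonalGroup (Fin 3) ℝ)
    (hgd : (gd t).R ∈ Matrix.specialOrthogonalGroup (Fin 3) ℝ)
    (hp : HasDerivWithinAt (fun s => (g s).p) ((g t).R *ᵥ (fun k => V (Sum.inl k))) S t)
    (hpd : HasDerivWithinAt (fun s => (gd s).p) ((gd t).R *ᵥ (fun k => Vd (Sum.inl k))) S t)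
    (hRd : MatHasDerivWithinAt (fun s => (gd s).R) ((gd t).R * hat (fun k => Vd (Sum.inr k))) S t) :
    HasDerivWithinAt (fun s => relPos (g s) (gd s)) (relRot (g t) (gd t) *ᵥ
      (fun k => (V - VdStar (g t) (gd t) Vd) (Sum.inl k))) S t := by
  have h := hRd.transpose.mulVec (hp.sub hpd)
  have hQ := relRot_mem hg hgd
  set Q := relRot (g t) (gd t) with hQdef
  set r := relPos (g t) (gd t) with hr
  set w : Fin 3 → ℝ := fun k => V (Sum.inl k)
  set wd : Fin 3 → ℝ := fun k => Vd (Sum.inr k)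
  set vd : Fin 3 → ℝ := fun k => Vd (Sum.inl k)
  have e1 : (fun k => (V - VdStar (g t) (gd t) Vd) (Sum.inl k)) =
      w - (Qᵀ *ᵥ vd - (hat (Qᵀ *ᵥ r) * Qᵀ) *ᵥ wd) := by
    ext k
    simp only [VdStar, Ad_eq hgd, relAd, ← hQdef, ← hr, Matrix.fromBlocks_mulVec, Pi.sub_apply,
      Sum.elim_inl, w, hat_neg, neg_mul, Matrix.neg_mulVec, sub_eq_add_neg]
    rfl
  have e2 : Q *ᵥ ((hat (Qᵀ *ᵥ r) * Qᵀ) *ᵥ wd) = hat r *ᵥ wd := by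
    rw [Matrix.mulVec_mulVec, ← mul_assoc, mul_hat_transpose_mulVec hQ]
  rw [e1, Matrix.mulVec_sub, Matrix.mulVec_sub, e2, Matrix.mulVec_mulVec vd,
    mul_transpose_self_of_mem hQ, Matrix.one_mulVec]
  refine h.congr_deriv ?_
  rw [Matrix.transpose_mul, hat_transpose, Matrix.mulVec_sub, Matrix.mulVec_mulVec,
    Matrix.mulVec_mulVec, transpose_mul_self_of_mem hgd, Matrix.one_mulVec, neg_mul,
    Matrix.neg_mulVec, ← Matrix.mulVec_mulVec]
  change -(hat wd *ᵥ r) + (Q *ᵥ w - vd) = Q *ᵥ w - (vd - hat r *ᵥ wd)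
  rw [hat_mulVec_comm r wd]
  abel

end RelativePose

/-- The elastic force is the gradient of the potential in the body frame; symmetry of the stiffness
matrices enters here. -/
theorem hasDerivWithinAt_potential {Kp KR : Matrix (Fin 3) (Fin 3) ℝ} (hKp : Kpᵀ = Kp)
    (hKR : KRᵀ = KR) {Q : ℝ → Matrix (Fin 3) (Fin 3) ℝ} {r : ℝ → Fin 3 → ℝ} {e : Six → ℝ}
    {S : Set ℝ} {t : ℝ}
    (hQ : MatHasDerivWithinAt Q (Q t * hat (fun k => e (Sum.inr k))) S t)
    (hr : HasDerivWithinAt r (Q t *ᵥ (fun k => e (Sum.inl k))) S t) :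
    HasDerivWithinAt (fun s => potential Kp KR (Q s) (r s)) (e ⬝ᵥ force Kp KR (Q t) (r t)) S t := by
  have hKpr : HasDerivWithinAt (fun s => Kp *ᵥ r s) (Kp *ᵥ (Q t *ᵥ (fun k => e (Sum.inl k)))) S t := by
    simpa using (MatHasDerivWithinAt.const Kp).mulVec hr
  have h1 := (hasDerivWithinAt_dotProduct hr hKpr).const_mul (1 / 2)
  have h2 := ((MatHasDerivWithinAt.const KR).mul
    ((MatHasDerivWithinAt.const (1 : Matrix (Fin 3) (Fin 3) ℝ)).sub hQ)).trace
  refine (h1.add h2).congr_deriv ?_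
  have e1 : r t ⬝ᵥ Kp *ᵥ Q t *ᵥ (fun k => e (Sum.inl k)) =
      (Q t *ᵥ (fun k => e (Sum.inl k))) ⬝ᵥ (Kp *ᵥ r t) := by
    have := Matrix.dotProduct_transpose_mulVec Kp (r t) (Q t *ᵥ (fun k => e (Sum.inl k)))
    rwa [hKp] at this
  have e2 : (Q t *ᵥ (fun k => e (Sum.inl k))) ⬝ᵥ (Kp *ᵥ r t) =
      (fun k => e (Sum.inl k)) ⬝ᵥ ((Q t)ᵀ *ᵥ (Kp *ᵥ r t)) := by
    rw [Matrix.dotProduct_transpose_mulVec, dotProduct_comm]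
  have e3 := trace_mul_hat (KR * Q t) (fun k => e (Sum.inr k))
  rw [Matrix.transpose_mul, hKR] at e3
  rw [e1, e2]
  simp only [zero_mul, zero_add, zero_sub, mul_neg, Matrix.trace_neg, ← mul_assoc, e3, neg_neg]
  rw [force, show e = Sum.elim (fun k => e (Sum.inl k)) (fun k => e (Sum.inr k)) from
    (Sum.elim_comp_inl_inr e).symm, sumElim_dotProduct_sumElim]
  simp
  ring

theorem transpose_eq_of_posDef {n : Type*} {A : Matrix n n ℝ} (hA : A.PosDef) : Aᵀ = A := by
  have h := hA.isHermitian
  rwa [Matrix.IsHermitian, Matrix.conjTranspose_eq_transpose_of_trivial] at h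

section ClosedLoop

variable {rob : Manipulator} {des : DesiredTrajectory} {Kp KR : Matrix (Fin 3) (Fin 3) ℝ}
  {Kd : Matrix Six Six ℝ} {S : Set ℝ} {q v a : ℝ → Six → ℝ} {t : ℝ}

/-- The velocity error pulled back to joint space. -/
noncomputable def jointError (rob : Manipulator) (des : DesiredTrajectory) (t : ℝ)
    (q v : Six → ℝ) : Six → ℝ :=
  (rob.J q)⁻¹ *ᵥ velError rob des t q v

/-- Kinetic energy of the velocity error plus elastic potential. -/
noncomputable def energy (rob : Manipulator) (des : DesiredTrajectory)
    (Kp KR : Matrix (Fin 3) (Fin 3) ℝ) (t : ℝ) (q v : Six → ℝ) : ℝ :=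
  (1 / 2) * (jointError rob des t q v ⬝ᵥ (rob.M q *ᵥ jointError rob des t q v)) +
    potential Kp KR (relRot (rob.fk q) (des.g t)) (relPos (rob.fk q) (des.g t))

theorem DesiredTrajectory.matHasDerivWithinAt_R (des : DesiredTrajectory) (hS : S ⊆ Ici 0)
    (ht : t ∈ S) : MatHasDerivWithinAt (fun s => (des.g s).R)
      ((des.g t).R * hat (fun k => des.V t (Sum.inr k))) S t :=
  fun i j => (des.deriv_R t (hS ht) i j).mono hS

theorem DesiredTrajectory.hasDerivWithinAt_p (des : DesiredTrajectory) (hS : S ⊆ Ici 0)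
    (ht : t ∈ S) : HasDerivWithinAt (fun s => (des.g s).p)
      ((des.g t).R *ᵥ (fun k => des.V t (Sum.inl k))) S t :=
  (des.deriv_p t (hS ht)).mono hS

theorem matHasDerivWithinAt_fk_R {w : Six → ℝ} (hq : HasDerivWithinAt q w S t) :
    MatHasDerivWithinAt (fun s => (rob.fk (q s)).R)
      ((rob.fk (q t)).R * hat (fun k => (rob.J (q t) *ᵥ w) (Sum.inr k))) S t := by
  rw [← rob.rotDeriv_eq]
  exact rob.matHasDerivWithinAt_R hq

theorem hasDerivWithinAt_fk_p {w : Six → ℝ} (hq : HasDerivWithinAt q w S t) :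
    HasDerivWithinAt (fun s => (rob.fk (q s)).p)
      ((rob.fk (q t)).R *ᵥ (fun k => (rob.J (q t) *ᵥ w) (Sum.inl k))) S t := by
  rw [← rob.posDeriv_eq]
  exact rob.hasDerivWithinAt_p hq

theorem matHasDerivWithinAt_relRot_velError (hS : S ⊆ Ici 0) (ht : t ∈ S)
    (hq : HasDerivWithinAt q (v t) S t) :
    MatHasDerivWithinAt (fun s => relRot (rob.fk (q s)) (des.g s))
      (relRot (rob.fk (q t)) (des.g t) *
        hat (fun k => velError rob des t (q t) (v t) (Sum.inr k))) S t :=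
  matHasDerivWithinAt_relRot (rob.rot _) (des.rot t (hS ht)) (matHasDerivWithinAt_fk_R hq)
    (des.matHasDerivWithinAt_R hS ht)

theorem hasDerivWithinAt_relPos_velError (hS : S ⊆ Ici 0) (ht : t ∈ S)
    (hq : HasDerivWithinAt q (v t) S t) :
    HasDerivWithinAt (fun s => relPos (rob.fk (q s)) (des.g s))
      (relRot (rob.fk (q t)) (des.g t) *ᵥ
        (fun k => velError rob des t (q t) (v t) (Sum.inl k))) S t :=
  hasDerivWithinAt_relPos (rob.rot _) (des.rot t (hS ht)) (hasDerivWithinAt_fk_p hq)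
    (des.hasDerivWithinAt_p hS ht) (des.matHasDerivWithinAt_R hS ht)

/-- Guarantees that the `derivWithin` in the control law is a true derivative and not the default
value zero. -/
theorem differentiableWithinAt_VdStar (hS : S ⊆ Ici 0) (ht : t ∈ S)
    (hq : HasDerivWithinAt q (v t) S t) :
    DifferentiableWithinAt ℝ (fun s => VdStar (rob.fk (q s)) (des.g s) (des.V s)) S t := by
  have hR := (matHasDerivWithinAt_fk_R (rob := rob) hq).transpose
  have hp := hasDerivWithinAt_fk_p (rob := rob) hq
  have hQ := hR.mul (des.matHasDerivWithinAt_R hS ht)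
  have hh := (MatHasDerivWithinAt.hat
    (hR.mulVec (hp.sub (des.hasDerivWithinAt_p hS ht))).neg).mul hQ
  have hV := ((des.diff_V t (hS ht)).mono hS).hasDerivWithinAt
  exact ((hQ.fromBlocks hh (MatHasDerivWithinAt.const 0) hQ).mulVec hV).differentiableWithinAt

theorem J_mulVec_jointError (hJ : (rob.J (q t)).det ≠ 0) :
    rob.J (q t) *ᵥ jointError rob des t (q t) (v t) = velError rob des t (q t) (v t) := by
  rw [jointError, Matrix.mulVec_mulVec, Matrix.mul_nonsing_inv _ (isUnit_iff_ne_zero.2 hJ),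
    Matrix.one_mulVec]

theorem transpose_mulVec_controlWrench {q v w : Six → ℝ} (hJ : (rob.J q).det ≠ 0) :
    (rob.J q)ᵀ *ᵥ controlWrench rob des Kp KR Kd t q v w =
      rob.M q *ᵥ ((rob.J q)⁻¹ *ᵥ w) +
        (rob.C q v *ᵥ ((rob.J q)⁻¹ *ᵥ VdStar (rob.fk q) (des.g t) (des.V t))
        - rob.M q *ᵥ ((rob.J q)⁻¹ *ᵥ (rob.Jdot q v *ᵥ
          ((rob.J q)⁻¹ *ᵥ VdStar (rob.fk q) (des.g t) (des.V t))))) + rob.G q -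
      (rob.J q)ᵀ *ᵥ (elasticForce Kp KR (rob.fk q) (des.g t) +
        Kd *ᵥ velError rob des t q v) := by
  have h1 : (rob.J q)ᵀ * ((rob.J q)⁻¹)ᵀ = 1 := by
    rw [← Matrix.transpose_mul, Matrix.nonsing_inv_mul _ (isUnit_iff_ne_zero.2 hJ),
      Matrix.transpose_one]
  have h2 : ∀ x, (rob.J q)ᵀ *ᵥ (((rob.J q)⁻¹)ᵀ *ᵥ x) = x := fun x => by
    rw [Matrix.mulVec_mulVec, h1, Matrix.one_mulVec]
  simp only [controlWrench, Manipulator.Mt, Manipulator.Ct, Manipulator.Gt, Matrix.mulVec_sub,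
    Matrix.mulVec_add, ← Matrix.mulVec_mulVec, h2, Matrix.sub_mulVec]
  abel

/-- Subtracting the control torque from the equations of motion removes gravity and all feedforward
terms. What remains is an equation for `J⁻¹ e_V` with the same `M` and `C`, so the energy argument
for the uncontrolled arm applies to it. -/
theorem IsClosedLoopMotion.hasDerivWithinAt_jointError
    (h : IsClosedLoopMotion rob des Kp KR Kd S q v a) (hS : S ⊆ Ici 0) (ht : t ∈ S)
    (hu : UniqueDiffWithinAt ℝ S t) :
    ∃ u', HasDerivWithinAt (fun s => jointError rob des s (q s) (v s)) u' S t ∧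
      HasDerivWithinAt (fun s => velError rob des s (q s) (v s))
        (rob.Jdot (q t) (v t) *ᵥ jointError rob des t (q t) (v t) + rob.J (q t) *ᵥ u') S t ∧
      rob.M (q t) *ᵥ u' + rob.C (q t) (v t) *ᵥ jointError rob des t (q t) (v t) =
        -((rob.J (q t))ᵀ *ᵥ (force Kp KR (relRot (rob.fk (q t)) (des.g t))
          (relPos (rob.fk (q t)) (des.g t)) + Kd *ᵥ velError rob des t (q t) (v t))) := by
  have hq := h.vel t ht
  have hJ := h.nonsingular t ht
  have hW := (differentiableWithinAt_VdStar (rob := rob) (des := des) hS ht hq).hasDerivWithinAt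
  have hdyn := h.dynamics t ht
  set W' := derivWithin (fun s => VdStar (rob.fk (q s)) (des.g s) (des.V s)) S t with hW'
  have hJd := rob.matHasDerivWithinAt_J hq
  have he := (hJd.mulVec (h.acc t ht)).sub hW
  have hinv : MatHasDerivWithinAt (fun s => (rob.J (q s))⁻¹) _ S t :=
    fun i j => (hJd.differentiableWithinAt_inv hJ i j).hasDerivWithinAt
  -- At first only existence of `u'` is obtained. Its value follows from comparing two derivatives
  -- of the velocity error, once as `J u` and once as `J q̇ - V_d^*`.
  obtain ⟨u', hu'⟩ : ∃ u', HasDerivWithinAt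
      (fun s => jointError rob des s (q s) (v s)) u' S t := ⟨_, hinv.mulVec he⟩
  refine ⟨u', hu', ?_⟩
  have hue : HasDerivWithinAt (fun s => velError rob des s (q s) (v s)) _ S t :=
    (hJd.mulVec hu').congr (fun s hs => (J_mulVec_jointError (h.nonsingular s hs)).symm)
      (J_mulVec_jointError hJ).symm
  refine ⟨hue, ?_⟩
  have huniq := hu.eq_deriv _ hue he
  rw [transpose_mulVec_controlWrench hJ, elasticForce_eq] at hdyn
  have hcancel : ∀ x, (rob.J (q t))⁻¹ *ᵥ (rob.J (q t) *ᵥ x) = x := fun x => by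
    rw [Matrix.mulVec_mulVec, Matrix.nonsing_inv_mul _ (isUnit_iff_ne_zero.2 hJ),
      Matrix.one_mulVec]
  have hu_eq : jointError rob des t (q t) (v t) =
      v t - (rob.J (q t))⁻¹ *ᵥ VdStar (rob.fk (q t)) (des.g t) (des.V t) := by
    rw [jointError, velError, Matrix.mulVec_sub, hcancel]
  have hu'_eq : u' = a t - (rob.J (q t))⁻¹ *ᵥ W' + (rob.J (q t))⁻¹ *ᵥ (rob.Jdot (q t) (v t) *ᵥ
      ((rob.J (q t))⁻¹ *ᵥ VdStar (rob.fk (q t)) (des.g t) (des.V t))) := by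
    have h1 := congrArg (fun x => (rob.J (q t))⁻¹ *ᵥ x) huniq
    simp only [hu_eq, Matrix.mulVec_sub, Matrix.mulVec_add, hcancel] at h1
    rw [← sub_eq_zero] at h1 ⊢
    rw [← h1]
    abel
  rw [hu'_eq, hu_eq]
  simp only [Matrix.mulVec_sub, Matrix.mulVec_add] at hdyn ⊢
  rw [← sub_eq_zero] at hdyn ⊢
  rw [← hdyn]
  abel

/-- Two cancellations leave only the damping: `½ u·Ṁu` against `u·Cu`, and the rate of change of the
potential against the work `e_V·f` of the elastic force. -/
theorem IsClosedLoopMotion.hasDerivWithinAt_energy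
    (h : IsClosedLoopMotion rob des Kp KR Kd S q v a) (hKp : Kpᵀ = Kp) (hKR : KRᵀ = KR)
    (hS : S ⊆ Ici 0) (ht : t ∈ S) (hu : UniqueDiffWithinAt ℝ S t) :
    HasDerivWithinAt (fun s => energy rob des Kp KR s (q s) (v s))
      (-(velError rob des t (q t) (v t) ⬝ᵥ (Kd *ᵥ velError rob des t (q t) (v t)))) S t := by
  obtain ⟨u', hu', -, heq⟩ := h.hasDerivWithinAt_jointError hS ht hu
  have hq := h.vel t ht
  have hpot := hasDerivWithinAt_potential hKp hKR
    (matHasDerivWithinAt_relRot_velError (rob := rob) (des := des) hS ht hq)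
    (hasDerivWithinAt_relPos_velError hS ht hq)
  have hkin := (hasDerivWithinAt_dotProduct hu'
    ((rob.matHasDerivWithinAt_M hq).mulVec hu')).const_mul (1 / 2)
  refine (hkin.add hpot).congr_deriv ?_
  have hC := rob.dotProduct_C_mulVec (q t) (v t) (jointError rob des t (q t) (v t))
  have he := J_mulVec_jointError (des := des) (v := v) (h.nonsingular t ht)
  set u := jointError rob des t (q t) (v t)
  set e := velError rob des t (q t) (v t)
  set f := force Kp KR (relRot (rob.fk (q t)) (des.g t)) (relPos (rob.fk (q t)) (des.g t))
  have hM : (rob.M (q t))ᵀ = rob.M (q t) :=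
    transpose_eq_of_posDef (rob.posDef_M (q t))
  have h1 : u' ⬝ᵥ (rob.M (q t) *ᵥ u) = u ⬝ᵥ (rob.M (q t) *ᵥ u') := by
    have := Matrix.dotProduct_transpose_mulVec (rob.M (q t)) u' u
    rwa [hM] at this
  have h2 : u ⬝ᵥ (rob.M (q t) *ᵥ u') + u ⬝ᵥ (rob.C (q t) (v t) *ᵥ u) =
      -(e ⬝ᵥ f + e ⬝ᵥ (Kd *ᵥ e)) := by
    rw [← dotProduct_add, heq, dotProduct_neg, Matrix.dotProduct_transpose_mulVec, he,
      dotProduct_comm, dotProduct_add]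
  rw [h1, dotProduct_add]
  linarith

theorem IsClosedLoopMotion.energy_le
    (h : IsClosedLoopMotion rob des Kp KR Kd S q v a) (hKp : Kp.PosDef) (hKR : KR.PosDef)
    (hKd : Kd.PosDef) (hS : S ⊆ Ici 0) (hSc : S.OrdConnected) (hu : UniqueDiffOn ℝ S)
    {t₀ : ℝ} (ht₀ : t₀ ∈ S) (ht : t ∈ S) (hle : t₀ ≤ t) :
    energy rob des Kp KR t (q t) (v t) ≤ energy rob des Kp KR t₀ (q t₀) (v t₀) := by
  refine antitoneOn_of_hasDerivWithinAt_nonpos hSc (fun t ht => h.hasDerivWithinAt_energy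
    (transpose_eq_of_posDef hKp) (transpose_eq_of_posDef hKR) hS ht (hu t ht))
    (fun t ht => ?_) ht₀ ht hle
  have := hKd.posSemidef.dotProduct_mulVec_nonneg (velError rob des t (q t) (v t))
  simpa using this

/-! ### The desired motion as a solution of the closed loop -/

theorem relPos_self (g : Pose) : relPos g g = 0 := by simp [relPos]

theorem relRot_self {g : Pose} (hg : g.R ∈ Matrix.specialOrthogonalGroup (Fin 3) ℝ) :
    relRot g g = 1 := transpose_mul_self_of_mem hg

theorem VdStar_self {g : Pose} (hg : g.R ∈ Matrix.specialOrthogonalGroup (Fin 3) ℝ)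
    (V : Six → ℝ) : VdStar g g V = V := by
  have h0 : hat (-0) = 0 := by
    ext i j; fin_cases i <;> fin_cases j <;> simp [hat]
  rw [VdStar, Ad_eq hg, relPos_self, relRot_self hg, relAd]
  simp only [Matrix.transpose_one, Matrix.mulVec_zero, h0, Matrix.zero_mul, Matrix.fromBlocks_one,
    Matrix.one_mulVec]

theorem force_one_zero (Kp KR : Matrix (Fin 3) (Fin 3) ℝ) : force Kp KR 1 0 = 0 := by
  ext (i | i)
  · simp [force]
  · fin_cases i <;> simp [force, vee]

theorem J_mulVec_of_reach (hreach : ∀ t, 0 ≤ t → rob.fk (q t) = des.g t)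
    (hq : ∀ t, 0 ≤ t → HasDerivWithinAt q (v t) (Ici 0) t) (ht : 0 ≤ t) :
    rob.J (q t) *ᵥ v t = des.V t := by
  have hu := uniqueDiffOn_Ici (0 : ℝ) t ht
  have ht' : t ∈ Ici (0 : ℝ) := ht
  have hg := transpose_mul_self_of_mem (des.rot t ht)
  have hR := matHasDerivWithinAt_fk_R (rob := rob) (hq t ht)
  have hp := hasDerivWithinAt_fk_p (rob := rob) (hq t ht)
  have eR : (des.g t).R * hat (fun k => (rob.J (q t) *ᵥ v t) (Sum.inr k)) =
      (des.g t).R * hat (fun k => des.V t (Sum.inr k)) := by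
    ext i j
    rw [← hreach t ht]
    refine hu.eq_deriv _ (hR i j) ?_
    rw [hreach t ht]
    exact (des.matHasDerivWithinAt_R subset_rfl ht' i j).congr
      (fun s hs => congrArg (fun g : Pose => g.R i j) (hreach s hs))
      (congrArg (fun g : Pose => g.R i j) (hreach t ht))
  have ep : (des.g t).R *ᵥ (fun k => (rob.J (q t) *ᵥ v t) (Sum.inl k)) =
      (des.g t).R *ᵥ (fun k => des.V t (Sum.inl k)) := by
    rw [← hreach t ht]
    refine hu.eq_deriv _ hp ?_
    rw [hreach t ht]
    exact (des.hasDerivWithinAt_p subset_rfl ht').congr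
      (fun s hs => by rw [hreach s hs]) (by rw [hreach t ht])
  have eR' := congrArg (fun X => vee ((des.g t).Rᵀ * X)) eR
  have ep' := congrArg (fun x => (des.g t).Rᵀ *ᵥ x) ep
  simp only [← mul_assoc, hg, one_mul, vee_hat, Matrix.mulVec_mulVec, Matrix.one_mulVec] at eR' ep'
  ext (k | k)
  · exact congrFun ep' k
  · exact congrFun eR' k

/-- Along `q_d` the transported velocity equals `J q̇`, so its derivative is `J̇ q̇ + J q̈` and the
control law reduces to inverse dynamics. -/
theorem isClosedLoopMotion_of_reach (hreach : ∀ t, 0 ≤ t → rob.fk (q t) = des.g t)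
    (hq : ∀ t, 0 ≤ t → HasDerivWithinAt q (v t) (Ici 0) t)
    (hv : ∀ t, 0 ≤ t → HasDerivWithinAt v (a t) (Ici 0) t)
    (hJ : ∀ t, 0 ≤ t → (rob.J (q t)).det ≠ 0) :
    IsClosedLoopMotion rob des Kp KR Kd (Ici 0) q v a ∧
      ∀ t, 0 ≤ t → taskError rob des t (q t) (v t) = 0 ∧
        elasticForce Kp KR (rob.fk (q t)) (des.g t) = 0 := by
  have hV : ∀ t, 0 ≤ t → VdStar (rob.fk (q t)) (des.g t) (des.V t) = rob.J (q t) *ᵥ v t :=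
    fun t ht => by rw [hreach t ht, VdStar_self (des.rot t ht), J_mulVec_of_reach hreach hq ht]
  have he : ∀ t, 0 ≤ t → velError rob des t (q t) (v t) = 0 := fun t ht => by
    rw [velError, hV t ht, sub_self]
  have hf : ∀ t, 0 ≤ t → elasticForce Kp KR (rob.fk (q t)) (des.g t) = 0 := fun t ht => by
    rw [elasticForce_eq, hreach t ht, relPos_self, relRot_self (des.rot t ht), force_one_zero]
  refine ⟨⟨hq, hv, hJ, fun t ht => ?_⟩, fun t ht => ⟨?_, hf t ht⟩⟩
  · have hd : derivWithin (fun s => VdStar (rob.fk (q s)) (des.g s) (des.V s)) (Ici 0) t =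
        rob.Jdot (q t) (v t) *ᵥ v t + rob.J (q t) *ᵥ a t :=
      (((rob.matHasDerivWithinAt_J (hq t ht)).mulVec (hv t ht)).congr (fun s hs => hV s hs)
        (hV t ht)).derivWithin (uniqueDiffOn_Ici (0 : ℝ) t ht)
    have hcancel : ∀ x, (rob.J (q t))⁻¹ *ᵥ (rob.J (q t) *ᵥ x) = x := fun x => by
      rw [Matrix.mulVec_mulVec, Matrix.nonsing_inv_mul _ (isUnit_iff_ne_zero.2 (hJ t ht)),
        Matrix.one_mulVec]
    rw [hd, transpose_mulVec_controlWrench (hJ t ht), hf t ht, he t ht, hV t ht]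
    simp only [Matrix.mulVec_add, hcancel, Matrix.mulVec_zero, add_zero, sub_zero]
    abel
  · simp [taskError, he t ht, hreach t ht]

end ClosedLoop

/-! ### Periodicity and compactness -/

/-- The shift is chosen before the function `F`, so one translation serves the Jacobian, the forward
kinematics and all the manipulator data at once. -/
theorem exists_period_add_mem_Icc (q : Six → ℝ) : ∃ c : Six → ℝ,
    q + c ∈ Icc (0 : Six → ℝ) (fun _ => 2 * Real.pi) ∧
    ∀ {β : Type} (F : (Six → ℝ) → β),
      (∀ i, Function.Periodic F (Pi.single i (2 * Real.pi))) → Function.Periodic F c := by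
  have h : ∀ i, ∃ m : ℤ, q i + m • (2 * Real.pi) ∈ Ico (0 : ℝ) (0 + 2 * Real.pi) := fun i =>
    (existsUnique_add_zsmul_mem_Ico Real.two_pi_pos (q i) 0).exists
  choose m hm using h
  refine ⟨∑ i, m i • Pi.single i (2 * Real.pi), ?_, fun F hF => ?_⟩
  · have e : ∀ j, (∑ i, m i • (Pi.single i (2 * Real.pi) : Six → ℝ)) j = m j • (2 * Real.pi) :=
      fun j => by
        rw [Finset.sum_apply, Finset.sum_eq_single j] <;> simp +contextual
    constructor <;> intro j
    · have := (hm j).1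
      rwa [← e j] at this
    · have := (hm j).2.le
      rwa [← e j, zero_add] at this
  · refine Finset.sum_induction _ (Function.Periodic F) (fun a b ha hb => ha.add_period hb)
      (by intro x; simp) (fun i _ => (hF i).zsmul _)

theorem pderiv_add_period {f : (Six → ℝ) → ℝ} {c : Six → ℝ} (hf : Function.Periodic f c) (k : Six)
    (q : Six → ℝ) : pderiv k f (q + c) = pderiv k f q := by
  have h := fderiv_comp_add_right (𝕜 := ℝ) (f := f) (x := q) c
  rw [show (fun x => f (x + c)) = f from funext hf] at h
  rw [pderiv, pderiv, h]

/-- Jacobian, inertia matrix, their inverses and their partial derivatives. -/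
abbrev ArmData := (Matrix Six Six ℝ × Matrix Six Six ℝ) × (Matrix Six Six ℝ × Matrix Six Six ℝ) ×
  (Six → Matrix Six Six ℝ) × (Six → Matrix Six Six ℝ)

namespace Manipulator

variable (rob : Manipulator)

/-- The data of the manipulator that enter the error dynamics. -/
noncomputable def data (q : Six → ℝ) : ArmData :=
  ((rob.J q, (rob.J q)⁻¹), (rob.M q, (rob.M q)⁻¹),
    fun k => Matrix.of fun i j => pderiv k (fun x => rob.J x i j) q,
    fun k => Matrix.of fun i j => pderiv k (fun x => rob.M x i j) q)

theorem periodic_J (i : Six) : Function.Periodic rob.J (Pi.single i (2 * Real.pi)) := fun q => by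
  have hR : ∀ k b c, pderiv k (fun x => (rob.fk x).R b c) (q + Pi.single i (2 * Real.pi)) =
      pderiv k (fun x => (rob.fk x).R b c) q :=
    fun k b c => pderiv_add_period (fun x => by simp only [rob.periodic_fk]) k q
  have hp : ∀ k b, pderiv k (fun x => (rob.fk x).p b) (q + Pi.single i (2 * Real.pi)) =
      pderiv k (fun x => (rob.fk x).p b) q :=
    fun k b => pderiv_add_period (fun x => by simp only [rob.periodic_fk]) k q
  simp only [J, rob.periodic_fk, hR, hp]

theorem periodic_data (i : Six) : Function.Periodic rob.data (Pi.single i (2 * Real.pi)) :=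
  fun q => by
  have hJ : ∀ k b c, pderiv k (fun x => rob.J x b c) (q + Pi.single i (2 * Real.pi)) =
      pderiv k (fun x => rob.J x b c) q :=
    fun k b c => pderiv_add_period (fun x => by simp only [rob.periodic_J i x]) k q
  have hM : ∀ k b c, pderiv k (fun x => rob.M x b c) (q + Pi.single i (2 * Real.pi)) =
      pderiv k (fun x => rob.M x b c) q :=
    fun k b c => pderiv_add_period (fun x => by simp only [rob.periodic_M]) k q
  simp only [data, rob.periodic_J i q, rob.periodic_M, hJ, hM]

theorem continuous_J : Continuous rob.J :=
  continuous_matrix fun i j => (rob.contDiff_J i j).continuous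

theorem continuous_M : Continuous rob.M :=
  continuous_matrix fun i j => (rob.smooth_M i j).continuous

theorem isCompact_nonsingular (ρ : ℝ) :
    IsCompact {q ∈ Icc (0 : Six → ℝ) (fun _ => 2 * Real.pi) | ρ ≤ |(rob.J q).det|} :=
  isCompact_Icc.inter_right (isClosed_le continuous_const rob.continuous_J.matrix_det.abs)

/-- The nonsingular region is unbounded in angle space, but by periodicity its image is already
attained on one period box. There the inverses are continuous, because the determinants do not
vanish. -/
theorem isCompact_data {ρ : ℝ} (hρ : 0 < ρ) :
    IsCompact (rob.data '' {q | ρ ≤ |(rob.J q).det|}) := by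
  have himg : rob.data '' {q | ρ ≤ |(rob.J q).det|} =
      rob.data '' {q ∈ Icc (0 : Six → ℝ) (fun _ => 2 * Real.pi) | ρ ≤ |(rob.J q).det|} := by
    refine subset_antisymm ?_ (image_mono fun q hq => hq.2)
    rintro _ ⟨q, hq, rfl⟩
    obtain ⟨c, hc, hper⟩ := exists_period_add_mem_Icc q
    refine ⟨q + c, ⟨hc, ?_⟩, hper rob.data rob.periodic_data q⟩
    rw [hper rob.J rob.periodic_J q]
    exact hq
  rw [himg]
  refine (rob.isCompact_nonsingular ρ).image_of_continuousOn ?_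
  have hinv : ∀ A : (Six → ℝ) → Matrix Six Six ℝ, Continuous A → (∀ q ∈ {q ∈ Icc (0 : Six → ℝ)
      (fun _ => 2 * Real.pi) | ρ ≤ |(rob.J q).det|}, (A q).det ≠ 0) →
      ContinuousOn (fun q => (A q)⁻¹) {q ∈ Icc (0 : Six → ℝ)
      (fun _ => 2 * Real.pi) | ρ ≤ |(rob.J q).det|} := fun A hA hd => by
    simp only [Matrix.inv_def, Ring.inverse_eq_inv']
    exact (hA.matrix_det.continuousOn.inv₀ hd).smul hA.matrix_adjugate.continuousOn
  refine (rob.continuous_J.continuousOn.prodMk (hinv _ rob.continuous_J fun q hq h0 => ?_)).prodMk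
    ((rob.continuous_M.continuousOn.prodMk (hinv _ rob.continuous_M fun q hq => ?_)).prodMk
    (Continuous.continuousOn (Continuous.prodMk ?_ ?_)))
  · have := hq.2
    rw [h0, abs_zero] at this
    exact absurd this (not_le.2 hρ)
  · exact ((Matrix.isUnit_iff_isUnit_det _).1 (rob.posDef_M q).isUnit).ne_zero
  · refine continuous_pi fun k => continuous_matrix fun i j => ?_
    exact (contDiff_pderiv (n := 0) (by simpa using rob.contDiff_J i j) k).continuous
  · refine continuous_pi fun k => continuous_matrix fun i j => ?_
    exact (contDiff_pderiv (n := 0) (by simpa using rob.smooth_M i j) k).continuous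

end Manipulator

section Norms

attribute [local instance] Matrix.normedAddCommGroup Matrix.normedSpace

theorem norm_le_one_of_mem {Q : Matrix (Fin 3) (Fin 3) ℝ}
    (hQ : Q ∈ Matrix.specialOrthogonalGroup (Fin 3) ℝ) : ‖Q‖ ≤ 1 :=
  entrywise_sup_norm_bound_of_unitary (Matrix.mem_specialOrthogonalGroup_iff.1 hQ).1

theorem isCompact_closedBall_matrix (b : ℝ) :
    IsCompact (Metric.closedBall (0 : Matrix (Fin 3) (Fin 3) ℝ) b) := by
  have : ProperSpace (Matrix (Fin 3) (Fin 3) ℝ) := FiniteDimensional.proper ℝ _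
  exact isCompact_closedBall _ _

theorem abs_dotProduct_le {n : Type*} [Fintype n] (x y : n → ℝ) :
    |x ⬝ᵥ y| ≤ Fintype.card n * ‖x‖ * ‖y‖ := by
  calc |x ⬝ᵥ y| ≤ ∑ i, |x i * y i| := Finset.abs_sum_le_sum_abs _ _
    _ ≤ ∑ _i : n, ‖x‖ * ‖y‖ := by
        refine Finset.sum_le_sum fun i _ => ?_
        rw [abs_mul]
        exact mul_le_mul (norm_le_pi_norm x i) (norm_le_pi_norm y i) (abs_nonneg _) (norm_nonneg _)
    _ = _ := by simp [mul_assoc]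

/-! ### Bounds for the elastic force and potential -/

section Elastic

variable {Kp KR : Matrix (Fin 3) (Fin 3) ℝ}

theorem mulVec_ne_zero_of_posDef {n : Type*} [Fintype n] {A : Matrix n n ℝ} (hA : A.PosDef)
    {x : n → ℝ} (hx : x ≠ 0) : A *ᵥ x ≠ 0 := fun h => by
  have := hA.dotProduct_mulVec_pos hx
  simp [h] at this

theorem dotProduct_self_pos {n : Type*} [Fintype n] {x : n → ℝ} (hx : x ≠ 0) : 0 < x ⬝ᵥ x := by
  have := dotProduct_star_self_pos_iff.2 hx
  simpa using this

/-- Expanding the right side with `Q Qᵀ = 1` turns an expression linear in `Q` into a quadratic form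
in `1 - Q`. -/
theorem trace_mul_one_sub {Q : Matrix (Fin 3) (Fin 3) ℝ}
    (hQ : Q ∈ Matrix.specialOrthogonalGroup (Fin 3) ℝ) (hKR : KRᵀ = KR) :
    (KR * (1 - Q)).trace = (1 / 2) * ((1 - Q)ᵀ * KR * (1 - Q)).trace := by
  have h1 : (Qᵀ * KR).trace = (KR * Q).trace := by
    rw [← Matrix.trace_transpose, Matrix.transpose_mul, Matrix.transpose_transpose, hKR]
  have h2 : (Qᵀ * KR * Q).trace = KR.trace := by
    rw [Matrix.trace_mul_comm, ← mul_assoc, mul_transpose_self_of_mem hQ, one_mul]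
  simp only [Matrix.transpose_sub, Matrix.transpose_one, mul_sub, sub_mul, Matrix.trace_sub,
    one_mul, mul_one, h1, h2]
  ring

theorem trace_transpose_mul_mul_pos (hKR : KR.PosDef) {X : Matrix (Fin 3) (Fin 3) ℝ} (hX : X ≠ 0) :
    0 < (Xᵀ * KR * X).trace := by
  have e : (Xᵀ * KR * X).trace = ∑ j, Xᵀ j ⬝ᵥ (KR *ᵥ Xᵀ j) := by
    simp only [Matrix.trace, Matrix.diag_apply, mul_assoc]
    rfl
  rw [e]
  obtain ⟨j, hj⟩ : ∃ j, Xᵀ j ≠ 0 := by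
    by_contra! h
    exact hX (by ext i j; exact congrFun (h j) i)
  refine Finset.sum_pos' (fun j _ => ?_) ⟨j, Finset.mem_univ _, ?_⟩
  · simpa using hKR.posSemidef.dotProduct_mulVec_nonneg (Xᵀ j)
  · simpa using hKR.dotProduct_mulVec_pos hj

/-- By `trace_mul_one_sub` the potential is a positive definite quadratic form in `(1 - Q, r)`, so
the bounds hold on all rotations and not only near the identity. -/
theorem exists_potential_bounds (hKp : Kp.PosDef) (hKR : KR.PosDef) : ∃ c₁ c₂ : ℝ, 0 < c₁ ∧ 0 < c₂ ∧
    ∀ Q ∈ Matrix.specialOrthogonalGroup (Fin 3) ℝ, ∀ r : Fin 3 → ℝ,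
      c₁ * ‖(1 - Q, r)‖ ^ 2 ≤ potential Kp KR Q r ∧
      potential Kp KR Q r ≤ c₂ * ‖(1 - Q, r)‖ ^ 2 := by
  set F : Unit → Matrix (Fin 3) (Fin 3) ℝ × (Fin 3 → ℝ) → ℝ := fun _ z =>
    (1 / 2) * (z.2 ⬝ᵥ (Kp *ᵥ z.2)) + (1 / 2) * (z.1ᵀ * KR * z.1).trace with hF
  have hFc : Continuous (Function.uncurry F) := by
    simp only [hF, Function.uncurry_def]
    fun_prop
  have hom : ∀ x (t : ℝ) w, F x (t • w) = t ^ 2 * F x w := fun _ t w => by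
    simp [hF, Matrix.mulVec_smul, Matrix.trace_smul]
    ring
  obtain ⟨c₁, h₁, H₁⟩ := exists_le_of_homogeneous (isCompact_singleton (x := ())) F hFc hom
    (fun _ _ w hw => by
      have h1 : 0 ≤ w.2 ⬝ᵥ (Kp *ᵥ w.2) := by
        simpa using hKp.posSemidef.dotProduct_mulVec_nonneg w.2
      by_cases h : w.1 = 0
      · have h2 : w.2 ≠ 0 := fun h2 => hw (Prod.ext h h2)
        have := hKp.dotProduct_mulVec_pos h2
        simp only [star_trivial] at this
        simp [hF, h, this]
      · have := trace_transpose_mul_mul_pos hKR h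
        simp only [hF]
        linarith)
  obtain ⟨c₂, h₂, H₂⟩ := exists_norm_le_of_homogeneous (isCompact_singleton (x := ())) 2 two_ne_zero
    F hFc (fun x t w => by rw [hom x t w]; simp)
  refine ⟨c₁, c₂, h₁, h₂, fun Q hQ r => ?_⟩
  have e : potential Kp KR Q r = F () (1 - Q, r) := by
    simp only [potential, trace_mul_one_sub hQ (transpose_eq_of_posDef hKR), hF]
  rw [e]
  exact ⟨H₁ _ rfl _, (le_abs_self _).trans (H₂ _ rfl _)⟩

theorem norm_vee_le (A : Matrix (Fin 3) (Fin 3) ℝ) : ‖vee A‖ ≤ ‖A‖ := by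
  refine (pi_norm_le_iff_of_nonneg (norm_nonneg A)).2 fun i => ?_
  fin_cases i
  · exact Matrix.norm_entry_le_entrywise_sup_norm A (i := 2) (j := 1)
  · exact Matrix.norm_entry_le_entrywise_sup_norm A (i := 0) (j := 2)
  · exact Matrix.norm_entry_le_entrywise_sup_norm A (i := 1) (j := 0)

theorem norm_elim_vee_le (x : Fin 3 → ℝ) (A : Matrix (Fin 3) (Fin 3) ℝ) :
    ‖(Sum.elim x (vee A) : Six → ℝ)‖ ≤ ‖(x, A)‖ := by
  refine (pi_norm_le_iff_of_nonneg (norm_nonneg (x, A))).2 fun i => ?_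
  rcases i with i | i
  · exact (norm_le_pi_norm x i).trans (norm_fst_le (x, A))
  · exact ((norm_le_pi_norm (vee A) i).trans (norm_vee_le A)).trans (norm_snd_le (x, A))

/-- The constant parts cancel: `K_R Q - Qᵀ K_R = Xᵀ K_R - K_R X` for `X = 1 - Q`, so for fixed
coefficient `Q` the force is linear in `(X, r)`. -/
theorem exists_force_le (Kp KR : Matrix (Fin 3) (Fin 3) ℝ) : ∃ c : ℝ, 0 < c ∧
    ∀ Q ∈ Matrix.specialOrthogonalGroup (Fin 3) ℝ, ∀ r : Fin 3 → ℝ,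
      ‖force Kp KR Q r‖ ≤ c * ‖(1 - Q, r)‖ := by
  obtain ⟨c, hc, H⟩ := exists_norm_le_of_smul (isCompact_closedBall_matrix 1)
    (fun (Q : Matrix (Fin 3) (Fin 3) ℝ) (z : Matrix (Fin 3) (Fin 3) ℝ × (Fin 3 → ℝ)) =>
      ((Qᵀ *ᵥ (Kp *ᵥ z.2), z.1ᵀ * KR - KR * z.1) : (Fin 3 → ℝ) × Matrix (Fin 3) (Fin 3) ℝ))
    (by simp only [Function.uncurry_def]; fun_prop)
    (fun Q t w => by simp [Matrix.mulVec_smul, smul_sub])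
  refine ⟨c, hc, fun Q hQ r => ?_⟩
  have h := H Q (by simpa using norm_le_one_of_mem hQ) (1 - Q, r)
  have e : (1 - Q)ᵀ * KR - KR * (1 - Q) = KR * Q - Qᵀ * KR := by
    simp only [Matrix.transpose_sub, Matrix.transpose_one, sub_mul, mul_sub, one_mul, mul_one]
    abel
  simp only [e] at h
  exact (norm_elim_vee_le _ _).trans h

/-- The translational part holds globally, because `Qᵀ` is an isometry and `K_p` is invertible. The
rotational force may vanish at rotations other than the identity, so smallness of `1 - Q` is needed.
-/
theorem exists_norm_le_force (hKp : Kp.PosDef) (hKR : KR.PosDef) : ∃ s c : ℝ, 0 < s ∧ 0 < c ∧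
    ∀ Q ∈ Matrix.specialOrthogonalGroup (Fin 3) ℝ, ∀ r : Fin 3 → ℝ, ‖1 - Q‖ ≤ s →
      ‖(1 - Q, r)‖ ≤ c * ‖force Kp KR Q r‖ := by
  have hKRt := transpose_eq_of_posDef hKR
  obtain ⟨c₁, h₁, H₁⟩ := exists_le_of_homogeneous (isCompact_singleton (x := ()))
    (fun _ (r : Fin 3 → ℝ) => (Kp *ᵥ r) ⬝ᵥ (Kp *ᵥ r))
    (by simp only [Function.uncurry_def]; fun_prop)
    (fun _ t w => by simp [Matrix.mulVec_smul]; ring)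
    (fun _ _ w hw => dotProduct_self_pos (mulVec_ne_zero_of_posDef hKp hw))
  obtain ⟨c₂, h₂, H₂⟩ := exists_le_of_homogeneous (isCompact_singleton (x := ()))
    (fun _ (X : Matrix (Fin 3) (Fin 3) ℝ) => (Xᵀ * KR * X).trace)
    (by simp only [Function.uncurry_def]; fun_prop)
    (fun _ t w => by simp [Matrix.trace_smul]; ring)
    (fun _ _ w hw => trace_transpose_mul_mul_pos hKR hw)
  obtain ⟨c₃, h₃, H₃⟩ := exists_norm_le_of_homogeneous (isCompact_singleton (x := ())) 3
    three_ne_zero (fun _ (X : Matrix (Fin 3) (Fin 3) ℝ) => (Xᵀ * X * KR * X).trace)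
    (by simp only [Function.uncurry_def]; fun_prop)
    (fun _ t w => by simp [Matrix.trace_smul]; ring)
  -- For `‖X‖ ≤ c₂ / c₃` the cubic trace is at most half of the quadratic lower bound `2 c₂ ‖X‖²`.
  -- The `6` is three coordinates times the factor in `‖Xᵀ - X‖ ≤ 2 ‖X‖`; the `+ 1` avoids a square
  -- root, as `x ≤ (x + 1)²`.
  refine ⟨c₂ / c₃, max (3 / c₁ + 1) (6 / c₂), by positivity, by positivity, fun Q hQ r hs => ?_⟩
  set f := force Kp KR Q r with hf
  set fp : Fin 3 → ℝ := Qᵀ *ᵥ (Kp *ᵥ r) with hfp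
  set fR : Fin 3 → ℝ := vee (KR * Q - Qᵀ * KR) with hfR
  have hfp_le : ‖fp‖ ≤ ‖f‖ := (pi_norm_le_iff_of_nonneg (norm_nonneg _)).2 fun i =>
    norm_le_pi_norm f (Sum.inl i)
  have hfR_le : ‖fR‖ ≤ ‖f‖ := (pi_norm_le_iff_of_nonneg (norm_nonneg _)).2 fun i =>
    norm_le_pi_norm f (Sum.inr i)
  have hr : ‖r‖ ≤ (3 / c₁ + 1) * ‖f‖ := by
    have e : fp ⬝ᵥ fp = (Kp *ᵥ r) ⬝ᵥ (Kp *ᵥ r) := by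
      rw [hfp, Matrix.dotProduct_transpose_mulVec, Matrix.mulVec_mulVec _ Q,
        mul_transpose_self_of_mem hQ, Matrix.one_mulVec]
    have h1 := H₁ () rfl r
    have h2 := (le_abs_self _).trans (abs_dotProduct_le fp fp)
    simp only [Fintype.card_fin, Nat.cast_ofNat] at h2
    have h4 : c₁ * ‖r‖ ^ 2 ≤ 3 * ‖f‖ ^ 2 := by nlinarith [norm_nonneg fp, norm_nonneg f]
    have h5 : ‖r‖ ^ 2 ≤ 3 / c₁ * ‖f‖ ^ 2 := by
      rw [div_mul_eq_mul_div, le_div_iff₀ h₁]; linarith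
    have h6 : (0 : ℝ) ≤ 3 / c₁ := by positivity
    refine le_of_sq_le_sq ?_ (by positivity)
    nlinarith [mul_nonneg h6 (sq_nonneg ‖f‖), mul_nonneg (mul_nonneg h6 h6) (sq_nonneg ‖f‖), sq_nonneg ‖f‖]
  have hS : ‖1 - Q‖ ≤ 6 / c₂ * ‖f‖ := by
    set X := 1 - Q with hX
    have hQX : Q = 1 - X := by rw [hX]; abel
    have hXX : X + Xᵀ = Xᵀ * X := by
      have := transpose_mul_self_of_mem hQ
      rw [hQX] at this
      simp only [Matrix.transpose_sub, Matrix.transpose_one, sub_mul, mul_sub, one_mul,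
        mul_one] at this
      rw [← sub_eq_zero] at this ⊢
      rw [← neg_eq_zero, ← this]
      abel
    have hhat : Xᵀ * KR - KR * X = hat fR := by
      rw [hfR, hat_vee, hQX]
      · simp only [Matrix.transpose_sub, Matrix.transpose_one, sub_mul, mul_sub, one_mul, mul_one]
        abel
      · simp only [Matrix.transpose_sub, Matrix.transpose_mul, hKRt, Matrix.transpose_transpose]
        abel
    -- Pairing the rotational force with the skew part of `X` gives a positive quadratic form up to
    -- a cubic error. Orthogonality of `Q`, in the form `X + Xᵀ = Xᵀ X`, produces that cubic term.
    have hG : 2 * (Xᵀ * KR * X).trace - (Xᵀ * X * KR * X).trace = fR ⬝ᵥ vee (Xᵀ - X) := by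
      have h1 := trace_mul_hat Xᵀ fR
      rw [Matrix.transpose_transpose, ← hhat] at h1
      have h2 : (Xᵀ * (Xᵀ * KR)).trace = (X * KR * X).trace := by
        rw [← Matrix.trace_transpose]
        simp only [Matrix.transpose_mul, Matrix.transpose_transpose, hKRt, mul_assoc]
        rw [← mul_assoc, Matrix.trace_mul_comm]
      have h3 : X * KR * X = Xᵀ * X * KR * X - Xᵀ * KR * X := by
        rw [← hXX]; simp only [add_mul]; abel
      rw [mul_sub, Matrix.trace_sub, h2, h3, Matrix.trace_sub, ← mul_assoc] at h1
      linarith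
    have h1 := H₂ () rfl X
    have h2 := (le_abs_self _).trans (H₃ () rfl X)
    have h3 := (le_abs_self _).trans (abs_dotProduct_le fR (vee (Xᵀ - X)))
    have h4 : ‖vee (Xᵀ - X)‖ ≤ 2 * ‖X‖ := by
      refine (norm_vee_le _).trans ((norm_sub_le _ _).trans (le_of_eq ?_))
      rw [Matrix.norm_transpose]
      ring
    simp only [Fintype.card_fin, Nat.cast_ofNat] at h3
    rcases (norm_nonneg X).eq_or_lt with h0 | h0
    · rw [← h0]; positivity
    · have h5 : c₃ * ‖X‖ ≤ c₂ := by rwa [le_div_iff₀' h₃] at hs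
      have h6 : ‖fR‖ * ‖vee (Xᵀ - X)‖ ≤ ‖f‖ * (2 * ‖X‖) := by gcongr
      have h7 : c₂ * ‖X‖ * ‖X‖ ≤ 6 * ‖f‖ * ‖X‖ := by
        have := mul_le_mul_of_nonneg_right h5 (sq_nonneg ‖X‖)
        nlinarith
      have h8 := le_of_mul_le_mul_right h7 h0
      rw [div_mul_eq_mul_div, le_div_iff₀ h₂]
      linarith
  rw [Prod.norm_def, max_le_iff]
  exact ⟨hS.trans (by gcongr; exact le_max_right _ _), hr.trans (by gcongr; exact le_max_left _ _)⟩

end Elastic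

/-! ### Bounds for the tracking error and the energy -/

/-- Deviation of a pose from a desired pose. -/
noncomputable def poseError (g gd : Pose) : ℝ :=
  ∑ i, ∑ j, |g.R i j - gd.R i j| + ‖g.p - gd.p‖

theorem poseError_le_norm (g gd : Pose) :
    poseError g gd ≤ 10 * ‖(gd.R - g.R, g.p - gd.p)‖ := by
  have h : ∀ i j, |g.R i j - gd.R i j| ≤ ‖(gd.R - g.R, g.p - gd.p)‖ := fun i j => by
    rw [abs_sub_comm]
    exact (Matrix.norm_entry_le_entrywise_sup_norm (gd.R - g.R) (i := i) (j := j)).trans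
      (norm_fst_le (gd.R - g.R, g.p - gd.p))
  have hp := norm_snd_le (gd.R - g.R, g.p - gd.p)
  have hs : ∑ i, ∑ j, |g.R i j - gd.R i j| ≤
      ∑ _i : Fin 3, ∑ _j : Fin 3, ‖(gd.R - g.R, g.p - gd.p)‖ :=
    Finset.sum_le_sum fun i _ => Finset.sum_le_sum fun j _ => h i j
  simp only [Finset.sum_const, Finset.card_univ, Fintype.card_fin, nsmul_eq_mul] at hs
  rw [poseError]
  push_cast at hs
  linarith

theorem norm_le_poseError (g gd : Pose) :
    ‖(gd.R - g.R, g.p - gd.p)‖ ≤ poseError g gd := by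
  have h0 : 0 ≤ ∑ i, ∑ j, |g.R i j - gd.R i j| :=
    Finset.sum_nonneg fun i _ => Finset.sum_nonneg fun j _ => abs_nonneg _
  rw [Prod.norm_def, max_le_iff]
  refine ⟨?_, by simp only [poseError]; linarith⟩
  refine (Matrix.norm_le_iff (add_nonneg h0 (norm_nonneg _))).2 fun i j => ?_
  have h1 : |g.R i j - gd.R i j| ≤ ∑ j, |g.R i j - gd.R i j| :=
    Finset.single_le_sum (f := fun j => |g.R i j - gd.R i j|) (fun j _ => abs_nonneg _)
      (Finset.mem_univ j)
  have h2 : ∑ j, |g.R i j - gd.R i j| ≤ ∑ i, ∑ j, |g.R i j - gd.R i j| :=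
    Finset.single_le_sum (f := fun i => ∑ j, |g.R i j - gd.R i j|)
      (fun i _ => Finset.sum_nonneg fun j _ => abs_nonneg _) (Finset.mem_univ i)
  change |gd.R i j - g.R i j| ≤ _
  rw [abs_sub_comm]
  linarith [norm_nonneg (g.p - gd.p)]

/-- Here `1 - Q = R_dᵀ (R_d - R)` and `r = R_dᵀ (p - p_d)`, and multiplication by `R_d` or its
transpose is uniformly bounded. -/
theorem exists_poseError_equiv : ∃ c : ℝ, 0 < c ∧ ∀ g gd : Pose,
    gd.R ∈ Matrix.specialOrthogonalGroup (Fin 3) ℝ →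
      poseError g gd ≤ c * ‖(1 - relRot g gd, relPos g gd)‖ ∧
      ‖(1 - relRot g gd, relPos g gd)‖ ≤ c * poseError g gd := by
  obtain ⟨c, hc, H⟩ := exists_norm_le_of_smul (isCompact_closedBall_matrix 1)
    (fun (Q : Matrix (Fin 3) (Fin 3) ℝ) (z : Matrix (Fin 3) (Fin 3) ℝ × (Fin 3 → ℝ)) =>
      ((Q * z.1, Q *ᵥ z.2) : Matrix (Fin 3) (Fin 3) ℝ × (Fin 3 → ℝ)))
    (by simp only [Function.uncurry_def]; fun_prop)
    (fun Q t w => by simp [Matrix.mulVec_smul])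
  refine ⟨10 * c, by positivity, fun g gd hgd => ⟨?_, ?_⟩⟩
  · have h := H gd.R (by simpa using norm_le_one_of_mem hgd) (1 - relRot g gd, relPos g gd)
    simp only [relRot, relPos, mul_sub, mul_one, ← mul_assoc, Matrix.mulVec_mulVec,
      mul_transpose_self_of_mem hgd, one_mul, Matrix.one_mulVec] at h
    have := poseError_le_norm g gd
    simp only [relRot, relPos]
    linarith
  · have h := H gd.Rᵀ (by simpa [Matrix.norm_transpose] using norm_le_one_of_mem hgd)
      (gd.R - g.R, g.p - gd.p)
    simp only [mul_sub, transpose_mul_self_of_mem hgd] at h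
    have h1 := norm_le_poseError g gd
    have h2 : 0 ≤ poseError g gd := (norm_nonneg _).trans h1
    simp only [relRot, relPos]
    nlinarith [mul_le_mul_of_nonneg_left h1 hc.le, mul_nonneg hc.le h2]

theorem taskError_eq (rob : Manipulator) (des : DesiredTrajectory) (t : ℝ) (q v : Six → ℝ) :
    taskError rob des t q v = poseError (rob.fk q) (des.g t) + ‖velError rob des t q v‖ := rfl

theorem poseError_nonneg (g gd : Pose) : 0 ≤ poseError g gd :=
  (norm_nonneg _).trans (norm_le_poseError g gd)

theorem taskError_nonneg (rob : Manipulator) (des : DesiredTrajectory) (t : ℝ) (q v : Six → ℝ) :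
    0 ≤ taskError rob des t q v :=
  add_nonneg (poseError_nonneg _ _) (norm_nonneg _)

/-! ### Uniform bounds away from singular configurations -/

section Arm

variable (rob : Manipulator) {ρ : ℝ}

theorem exists_kinetic_bounds (hρ : 0 < ρ) : ∃ c₁ c₂ : ℝ, 0 < c₁ ∧ 0 < c₂ ∧
    ∀ q, ρ ≤ |(rob.J q).det| → ∀ e : Six → ℝ,
      c₁ * ‖e‖ ^ 2 ≤ (1 / 2) * (((rob.J q)⁻¹ *ᵥ e) ⬝ᵥ (rob.M q *ᵥ ((rob.J q)⁻¹ *ᵥ e))) ∧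
      (1 / 2) * (((rob.J q)⁻¹ *ᵥ e) ⬝ᵥ (rob.M q *ᵥ ((rob.J q)⁻¹ *ᵥ e))) ≤ c₂ * ‖e‖ ^ 2 := by
  set F : ArmData → (Six → ℝ) → ℝ := fun D e =>
    (1 / 2) * ((D.1.2 *ᵥ e) ⬝ᵥ (D.2.1.1 *ᵥ (D.1.2 *ᵥ e))) with hF
  have hFc : Continuous (Function.uncurry F) := by
    simp only [hF, Function.uncurry_def]
    fun_prop
  have hom : ∀ x (t : ℝ) w, F x (t • w) = t ^ 2 * F x w := fun _ t w => by
    simp [hF, Matrix.mulVec_smul]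
    ring
  obtain ⟨c₁, h₁, H₁⟩ := exists_le_of_homogeneous (rob.isCompact_data hρ) F hFc hom (by
    rintro _ ⟨q, hq, rfl⟩ e he
    have hd : (rob.J q).det ≠ 0 := fun h0 => by
      rw [mem_ofPred_eq, h0, abs_zero] at hq
      exact absurd hq (not_le.2 hρ)
    have hne : (rob.J q)⁻¹ *ᵥ e ≠ 0 := fun h0 => he (by
      rw [← Matrix.one_mulVec e, ← Matrix.mul_nonsing_inv _ (isUnit_iff_ne_zero.2 hd),
        ← Matrix.mulVec_mulVec, h0, Matrix.mulVec_zero])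
    have := (rob.posDef_M q).dotProduct_mulVec_pos hne
    simp only [star_trivial] at this
    exact mul_pos one_half_pos this)
  obtain ⟨c₂, h₂, H₂⟩ := exists_norm_le_of_homogeneous (rob.isCompact_data hρ) 2 two_ne_zero
    F hFc (fun x t w => by rw [hom x t w]; simp)
  exact ⟨c₁, c₂, h₁, h₂, fun q hq e => ⟨H₁ _ (mem_image_of_mem _ hq) e,
    (le_abs_self _).trans (H₂ _ (mem_image_of_mem _ hq) e)⟩⟩

theorem exists_energy_bounds {Kp KR : Matrix (Fin 3) (Fin 3) ℝ} (hKp : Kp.PosDef)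
    (hKR : KR.PosDef) (des : DesiredTrajectory) (hρ : 0 < ρ) :
    ∃ c₁ c₂ : ℝ, 0 < c₁ ∧ 0 < c₂ ∧ ∀ t, 0 ≤ t → ∀ q v, ρ ≤ |(rob.J q).det| →
      c₁ * taskError rob des t q v ^ 2 ≤ energy rob des Kp KR t q v ∧
      energy rob des Kp KR t q v ≤ c₂ * taskError rob des t q v ^ 2 := by
  obtain ⟨k₁, k₂, hk₁, hk₂, Hk⟩ := exists_kinetic_bounds rob hρ
  obtain ⟨p₁, p₂, hp₁, hp₂, Hp⟩ := exists_potential_bounds hKp hKR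
  obtain ⟨c, hc, Hc⟩ := exists_poseError_equiv
  have hm : 0 < min (p₁ / c ^ 2) k₁ := by positivity
  refine ⟨min (p₁ / c ^ 2) k₁ / 2, p₂ * c ^ 2 + k₂, by positivity, by positivity,
    fun t ht q v hq => ?_⟩
  obtain ⟨a1, a2⟩ := Hk q hq (velError rob des t q v)
  obtain ⟨b1, b2⟩ := Hp _ (relRot_mem (rob.rot q) (des.rot t ht)) (relPos (rob.fk q) (des.g t))
  obtain ⟨d1, d2⟩ := Hc (rob.fk q) (des.g t) (des.rot t ht)
  rw [taskError_eq, energy, jointError]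
  set x := poseError (rob.fk q) (des.g t)
  set y := ‖velError rob des t q v‖
  set z := ‖(1 - relRot (rob.fk q) (des.g t), relPos (rob.fk q) (des.g t))‖
  have hx : 0 ≤ x := poseError_nonneg _ _
  have hy : 0 ≤ y := norm_nonneg _
  have hz : 0 ≤ z := norm_nonneg _
  have e1 : x ^ 2 ≤ c ^ 2 * z ^ 2 := by rw [← mul_pow]; gcongr
  have e2 : z ^ 2 ≤ c ^ 2 * x ^ 2 := by rw [← mul_pow]; gcongr
  have e3 : p₁ / c ^ 2 * x ^ 2 ≤ p₁ * z ^ 2 := by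
    calc p₁ / c ^ 2 * x ^ 2 ≤ p₁ / c ^ 2 * (c ^ 2 * z ^ 2) := by gcongr
      _ = p₁ * z ^ 2 := by field_simp
  have m1 := mul_le_mul_of_nonneg_right (min_le_left (p₁ / c ^ 2) k₁) (sq_nonneg x)
  have m2 := mul_le_mul_of_nonneg_right (min_le_right (p₁ / c ^ 2) k₁) (sq_nonneg y)
  constructor
  · have : (x + y) ^ 2 ≤ 2 * (x ^ 2 + y ^ 2) := by nlinarith [sq_nonneg (x - y)]
    have := mul_le_mul_of_nonneg_left this hm.le
    linarith
  · have : x ^ 2 + y ^ 2 ≤ (x + y) ^ 2 := by nlinarith [mul_nonneg hx hy]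
    have h1 := mul_le_mul_of_nonneg_left e2 hp₂.le
    have h2 : x ^ 2 ≤ (x + y) ^ 2 := by nlinarith [sq_nonneg y]
    have h3 : y ^ 2 ≤ (x + y) ^ 2 := by nlinarith [sq_nonneg x]
    have h4 : 0 ≤ p₂ * c ^ 2 := by positivity
    nlinarith [mul_le_mul_of_nonneg_left h2 h4, mul_le_mul_of_nonneg_left h3 hk₂.le]

theorem exists_inv_J_le (hρ : 0 < ρ) : ∃ c : ℝ, 0 < c ∧
    ∀ q, ρ ≤ |(rob.J q).det| → ∀ x : Six → ℝ, ‖(rob.J q)⁻¹ *ᵥ x‖ ≤ c * ‖x‖ := by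
  obtain ⟨c, hc, H⟩ := exists_norm_le_of_smul (rob.isCompact_data hρ)
    (fun (D : ArmData) (x : Six → ℝ) => D.1.2 *ᵥ x)
    (by simp only [Function.uncurry_def]; fun_prop) (fun Q t w => by simp [Matrix.mulVec_smul])
  exact ⟨c, hc, fun q hq x => H _ (mem_image_of_mem _ hq) x⟩

/-- `J M⁻¹ Jᵀ` is the inverse of the end-effector inertia. Its uniform positivity gives the negative
term in `f` in the derivative of the cross term. -/
theorem exists_le_inv_inertia (hρ : 0 < ρ) : ∃ c : ℝ, 0 < c ∧
    ∀ q, ρ ≤ |(rob.J q).det| → ∀ f : Six → ℝ,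
      c * ‖f‖ ^ 2 ≤ f ⬝ᵥ (rob.J q *ᵥ ((rob.M q)⁻¹ *ᵥ ((rob.J q)ᵀ *ᵥ f))) := by
  obtain ⟨c, hc, H⟩ := exists_le_of_homogeneous (rob.isCompact_data hρ)
    (fun (D : ArmData) (f : Six → ℝ) => f ⬝ᵥ (D.1.1 *ᵥ (D.2.1.2 *ᵥ (D.1.1ᵀ *ᵥ f))))
    (by simp only [Function.uncurry_def]; fun_prop)
    (fun _ t w => by simp [Matrix.mulVec_smul]; ring) (by
    rintro _ ⟨q, hq, rfl⟩ f hf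
    have hd : (rob.J q).det ≠ 0 := fun h0 => by
      rw [mem_ofPred_eq, h0, abs_zero] at hq
      exact absurd hq (not_le.2 hρ)
    have hne : (rob.J q)ᵀ *ᵥ f ≠ 0 := fun h0 => hf (by
      rw [← Matrix.one_mulVec f, ← Matrix.transpose_one,
        ← Matrix.mul_nonsing_inv _ (isUnit_iff_ne_zero.2 hd), Matrix.transpose_mul,
        ← Matrix.mulVec_mulVec, h0, Matrix.mulVec_zero])
    have := (rob.posDef_M q).inv.dotProduct_mulVec_pos hne
    simp only [star_trivial] at this
    change 0 < f ⬝ᵥ (rob.J q *ᵥ ((rob.M q)⁻¹ *ᵥ ((rob.J q)ᵀ *ᵥ f)))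
    rwa [← Matrix.dotProduct_transpose_mulVec, dotProduct_comm])
  exact ⟨c, hc, fun q hq x => H _ (mem_image_of_mem _ hq) x⟩

/-- The part of the error dynamics that is linear in the velocity error. -/
noncomputable def errorDrift (Kd : Matrix Six Six ℝ) (q v e : Six → ℝ) : Six → ℝ :=
  rob.Jdot q v *ᵥ ((rob.J q)⁻¹ *ᵥ e) -
    rob.J q *ᵥ ((rob.M q)⁻¹ *ᵥ (rob.C q v *ᵥ ((rob.J q)⁻¹ *ᵥ e) + (rob.J q)ᵀ *ᵥ (Kd *ᵥ e)))

/-- `J̇` and `C` are linear in the joint velocity, so the velocity must join the compact parameter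
set; hence the bound `b`. -/
theorem exists_errorDrift_le (Kd : Matrix Six Six ℝ) (hρ : 0 < ρ) (b : ℝ) : ∃ c : ℝ, 0 < c ∧
    ∀ q, ρ ≤ |(rob.J q).det| → ∀ v, ‖v‖ ≤ b → ∀ e : Six → ℝ,
      ‖errorDrift rob Kd q v e‖ ≤ c * ‖e‖ := by
  set Jd : ArmData × (Six → ℝ) → Matrix Six Six ℝ := fun x =>
    Matrix.of fun a i => ∑ k, x.1.2.2.1 k a i * x.2 k with hJd
  set Cd : ArmData × (Six → ℝ) → Matrix Six Six ℝ := fun x =>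
    Matrix.of fun i j => (1 / 2) * ∑ k,
      (x.1.2.2.2 k i j + x.1.2.2.2 j i k - x.1.2.2.2 i k j) * x.2 k with hCd
  have hel : ∀ k i j, Continuous fun x : ArmData × (Six → ℝ) => x.1.2.2.1 k i j := fun k i j =>
    Continuous.matrix_elem (by fun_prop) i j
  have hel' : ∀ k i j, Continuous fun x : ArmData × (Six → ℝ) => x.1.2.2.2 k i j := fun k i j =>
    Continuous.matrix_elem (by fun_prop) i j
  have hJc : Continuous Jd := continuous_matrix fun i j => by
    simp only [hJd, Matrix.of_apply]
    fun_prop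
  have hCc : Continuous Cd := continuous_matrix fun i j => by
    simp only [hCd, Matrix.of_apply]
    fun_prop
  obtain ⟨c, hc, H⟩ := exists_norm_le_of_smul
    ((rob.isCompact_data hρ).prod (isCompact_closedBall (0 : Six → ℝ) b))
    (fun (x : ArmData × (Six → ℝ)) (e : Six → ℝ) => Jd x *ᵥ (x.1.1.2 *ᵥ e) -
      x.1.1.1 *ᵥ (x.1.2.1.2 *ᵥ (Cd x *ᵥ (x.1.1.2 *ᵥ e) + x.1.1.1ᵀ *ᵥ (Kd *ᵥ e))))
    (by simp only [Function.uncurry_def]; fun_prop)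
    (fun Q t w => by simp only [Matrix.mulVec_smul, ← smul_add, ← smul_sub])
  exact ⟨c, hc, fun q hq v hv e => H (rob.data q, v) ⟨mem_image_of_mem _ hq, by simpa using hv⟩ e⟩

end Arm

/-! ### Convergence of the tracking error -/

theorem continuous_hat : Continuous hat := continuous_matrix fun i j => by
  fin_cases i <;> fin_cases j <;> simp [hat] <;> fun_prop

theorem hat_smul (c : ℝ) (w : Fin 3 → ℝ) : hat (c • w) = c • hat w := by
  ext i j
  fin_cases i <;> fin_cases j <;> simp [hat]

/-- Derivative of the elastic force along the velocity error `e`. -/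
def forceDeriv (Kp KR Q : Matrix (Fin 3) (Fin 3) ℝ) (r : Fin 3 → ℝ) (e : Six → ℝ) : Six → ℝ :=
  Sum.elim ((Q * hat (fun k => e (Sum.inr k)))ᵀ *ᵥ (Kp *ᵥ r) +
      Qᵀ *ᵥ (Kp *ᵥ (Q *ᵥ (fun k => e (Sum.inl k)))))
    (vee (KR * (Q * hat (fun k => e (Sum.inr k))) - (Q * hat (fun k => e (Sum.inr k)))ᵀ * KR))

theorem hasDerivWithinAt_force (Kp KR : Matrix (Fin 3) (Fin 3) ℝ)
    {Q : ℝ → Matrix (Fin 3) (Fin 3) ℝ} {r : ℝ → Fin 3 → ℝ} {e : Six → ℝ} {S : Set ℝ} {t : ℝ}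
    (hQ : MatHasDerivWithinAt Q (Q t * hat (fun k => e (Sum.inr k))) S t)
    (hr : HasDerivWithinAt r (Q t *ᵥ (fun k => e (Sum.inl k))) S t) :
    HasDerivWithinAt (fun s => force Kp KR (Q s) (r s)) (forceDeriv Kp KR (Q t) (r t) e) S t := by
  have hKpr : HasDerivWithinAt (fun s => Kp *ᵥ r s) (Kp *ᵥ (Q t *ᵥ (fun k => e (Sum.inl k)))) S t := by
    simpa using (MatHasDerivWithinAt.const Kp).mulVec hr
  have h1 := hasDerivWithinAt_pi.1 (hQ.transpose.mulVec hKpr)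
  have h2 : MatHasDerivWithinAt (fun s => KR * Q s - (Q s)ᵀ * KR)
      (KR * (Q t * hat (fun k => e (Sum.inr k))) -
        (Q t * hat (fun k => e (Sum.inr k)))ᵀ * KR) S t := by
    have := ((MatHasDerivWithinAt.const KR).mul hQ).sub
      (hQ.transpose.mul (MatHasDerivWithinAt.const KR))
    simpa using this
  refine hasDerivWithinAt_pi.2 ?_
  rintro (i | i)
  · exact h1 i
  · fin_cases i
    · exact h2 2 1
    · exact h2 0 2
    · exact h2 1 0

theorem exists_forceDeriv_le (Kp KR : Matrix (Fin 3) (Fin 3) ℝ) (b : ℝ) : ∃ c : ℝ, 0 < c ∧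
    ∀ Q ∈ Matrix.specialOrthogonalGroup (Fin 3) ℝ, ∀ r : Fin 3 → ℝ, ‖r‖ ≤ b → ∀ e : Six → ℝ,
      ‖forceDeriv Kp KR Q r e‖ ≤ c * ‖e‖ := by
  have hl : Continuous fun x : (Matrix (Fin 3) (Fin 3) ℝ × (Fin 3 → ℝ)) × (Six → ℝ) =>
      fun k => x.2 (Sum.inl k : Six) := by fun_prop
  have hr : Continuous fun x : (Matrix (Fin 3) (Fin 3) ℝ × (Fin 3 → ℝ)) × (Six → ℝ) =>
      hat (fun k => x.2 (Sum.inr k : Six)) := continuous_hat.comp (by fun_prop)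
  obtain ⟨c, hc, H⟩ := exists_norm_le_of_smul
    ((isCompact_closedBall_matrix 1).prod (isCompact_closedBall (0 : Fin 3 → ℝ) b))
    (fun (x : Matrix (Fin 3) (Fin 3) ℝ × (Fin 3 → ℝ)) (e : Six → ℝ) =>
      (((x.1 * hat (fun k => e (Sum.inr k)))ᵀ *ᵥ (Kp *ᵥ x.2) +
      x.1ᵀ *ᵥ (Kp *ᵥ (x.1 *ᵥ (fun k => e (Sum.inl k)))),
      KR * (x.1 * hat (fun k => e (Sum.inr k))) - (x.1 * hat (fun k => e (Sum.inr k)))ᵀ * KR) :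
      (Fin 3 → ℝ) × Matrix (Fin 3) (Fin 3) ℝ))
    (by simp only [Function.uncurry_def]; fun_prop)
    (fun Q t w => by
      have e1 : (fun k => (t • w) (Sum.inl k)) = t • fun k => w (Sum.inl k) := rfl
      have e2 : (fun k => (t • w) (Sum.inr k)) = t • fun k => w (Sum.inr k) := rfl
      simp only [e1, e2, hat_smul, Matrix.mul_smul, Matrix.transpose_smul, Matrix.smul_mulVec,
        Matrix.mulVec_smul, Matrix.smul_mul, ← smul_add, ← smul_sub, Prod.smul_mk])
  exact ⟨c, hc, fun Q hQ r hr e => (norm_elim_vee_le _ _).trans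
    (H (Q, r) ⟨by simpa using norm_le_one_of_mem hQ, by simpa using hr⟩ e)⟩

theorem exists_VdStar_le (b : ℝ) : ∃ c : ℝ, 0 < c ∧ ∀ g gd : Pose,
    g.R ∈ Matrix.specialOrthogonalGroup (Fin 3) ℝ →
    gd.R ∈ Matrix.specialOrthogonalGroup (Fin 3) ℝ → ‖relPos g gd‖ ≤ b →
      ∀ V, ‖VdStar g gd V‖ ≤ c * ‖V‖ := by
  have hh : Continuous fun x : (Matrix (Fin 3) (Fin 3) ℝ × (Fin 3 → ℝ)) =>
      relAd x.1 x.2 := by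
    unfold relAd
    have := continuous_hat.comp (f := fun x : (Matrix (Fin 3) (Fin 3) ℝ × (Fin 3 → ℝ)) =>
      -(x.1ᵀ *ᵥ x.2)) (by fun_prop)
    simp only [Function.comp_def] at this
    exact Continuous.matrix_fromBlocks (by fun_prop) (this.matrix_mul (by fun_prop))
      continuous_const (by fun_prop)
  obtain ⟨c, hc, H⟩ := exists_norm_le_of_smul
    ((isCompact_closedBall_matrix 1).prod (isCompact_closedBall (0 : Fin 3 → ℝ) b))
    (fun (x : Matrix (Fin 3) (Fin 3) ℝ × (Fin 3 → ℝ)) (V : Six → ℝ) => relAd x.1 x.2 *ᵥ V)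
    (by simp only [Function.uncurry_def]; fun_prop)
    (fun Q t w => by simp only [Matrix.mulVec_smul])
  refine ⟨c, hc, fun g gd hg hgd hr V => ?_⟩
  rw [VdStar, Ad_eq hgd]
  exact H (relRot g gd, relPos g gd)
    ⟨by simpa using norm_le_one_of_mem (relRot_mem hg hgd), by simpa using hr⟩ V

section Convergence

variable {rob : Manipulator} {des : DesiredTrajectory} {Kp KR : Matrix (Fin 3) (Fin 3) ℝ}
  {Kd : Matrix Six Six ℝ} {S : Set ℝ} {q v a : ℝ → Six → ℝ} {t : ℝ}

theorem IsClosedLoopMotion.hasDerivWithinAt_velError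
    (h : IsClosedLoopMotion rob des Kp KR Kd S q v a) (hS : S ⊆ Ici 0) (ht : t ∈ S)
    (hu : UniqueDiffWithinAt ℝ S t) :
    HasDerivWithinAt (fun s => velError rob des s (q s) (v s))
      (errorDrift rob Kd (q t) (v t) (velError rob des t (q t) (v t)) -
        rob.J (q t) *ᵥ ((rob.M (q t))⁻¹ *ᵥ ((rob.J (q t))ᵀ *ᵥ
          force Kp KR (relRot (rob.fk (q t)) (des.g t)) (relPos (rob.fk (q t)) (des.g t))))) S t := by
  obtain ⟨u', -, he, heq⟩ := h.hasDerivWithinAt_jointError hS ht hu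
  refine he.congr_deriv ?_
  have hM : ∀ x, (rob.M (q t))⁻¹ *ᵥ (rob.M (q t) *ᵥ x) = x := fun x => by
    rw [Matrix.mulVec_mulVec, Matrix.nonsing_inv_mul _
      ((Matrix.isUnit_iff_isUnit_det _).1 (rob.posDef_M (q t)).isUnit), Matrix.one_mulVec]
  rw [← eq_sub_iff_add_eq] at heq
  rw [← hM u', heq, errorDrift]
  simp only [jointError, Matrix.mulVec_add, Matrix.mulVec_sub, Matrix.mulVec_neg]
  abel

/-- `tendsto_zero_of_cross_term` is applied to the energy and the cross term `f·e_V`. The initial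
bound serves only to keep the relative pose where the force controls it and the velocities in a
fixed ball. -/
theorem exists_tendsto_taskError (rob : Manipulator) (des : DesiredTrajectory)
    (hKp : Kp.PosDef) (hKR : KR.PosDef) (hKd : Kd.PosDef)
    {B : ℝ} (hB : ∀ t, 0 ≤ t → ‖des.V t‖ ≤ B) {ρ : ℝ} (hρ : 0 < ρ) :
    ∃ δ : ℝ, 0 < δ ∧ ∀ t₀ : ℝ, 0 ≤ t₀ → ∀ q v a : ℝ → Six → ℝ,
      IsClosedLoopMotion rob des Kp KR Kd (Ici t₀) q v a →
      (∀ t ∈ Ici t₀, ρ ≤ |(rob.J (q t)).det|) → taskError rob des t₀ (q t₀) (v t₀) < δ →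
      Tendsto (fun t => taskError rob des t (q t) (v t)) atTop (𝓝 0) := by
  obtain ⟨c₁, c₂, hc₁, hc₂, hE⟩ := exists_energy_bounds rob hKp hKR des hρ
  obtain ⟨cz, hcz, hz⟩ := exists_poseError_equiv
  obtain ⟨s, cs, hs, hcs, hforce'⟩ := exists_norm_le_force hKp hKR
  obtain ⟨cf, hcf, hforce⟩ := exists_force_le Kp KR
  obtain ⟨cA, hcA, hVd⟩ := exists_VdStar_le s
  obtain ⟨cJ, hcJ, hJinv⟩ := exists_inv_J_le rob hρ
  -- The radius is the later bound on `v = J⁻¹ (e_V + V_d^*)`, with `‖e_V‖ ≤ s / cz` and `‖V_d^*‖ ≤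
  -- cA B`.
  obtain ⟨cL, hcL, hL⟩ := exists_errorDrift_le rob Kd hρ (cJ * (s / cz + cA * B))
  obtain ⟨cF, hcF, hF⟩ := exists_forceDeriv_le Kp KR s
  obtain ⟨ν, hν, hN⟩ := exists_le_inv_inertia rob hρ
  obtain ⟨k, hk, hKd'⟩ := exists_le_of_homogeneous (isCompact_singleton (x := ()))
    (fun _ (e : Six → ℝ) => e ⬝ᵥ (Kd *ᵥ e))
    (by simp only [Function.uncurry_def]; fun_prop)
    (fun _ t w => by simp [Matrix.mulVec_smul]; ring)
    (fun _ _ w hw => by simpa using hKd.dotProduct_mulVec_pos hw)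
  obtain ⟨p₁, p₂, hp₁, hp₂, hP⟩ := exists_potential_bounds hKp hKR
  obtain ⟨k₁, k₂, hk₁, hk₂, hK⟩ := exists_kinetic_bounds rob hρ
  -- Monotonicity of the energy costs a factor `√(c₂ / c₁)` in the task error, so the error stays
  -- below `s / cz` and the relative pose within `s`.
  refine ⟨Real.sqrt (c₁ / c₂) * (s / cz), by positivity, fun t₀ ht₀ q v a hmot hJ hinit => ?_⟩
  have hS : Ici t₀ ⊆ Ici (0 : ℝ) := Ici_subset_Ici.2 ht₀
  have hsmall : ∀ t ∈ Ici t₀, taskError rob des t (q t) (v t) ≤ s / cz := fun t ht => by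
    have h1 := (hE t (hS ht) (q t) (v t) (hJ t ht)).1
    have h2 := hmot.energy_le hKp hKR hKd hS ordConnected_Ici (uniqueDiffOn_Ici t₀)
      (mem_Ici.2 le_rfl) ht ht
    have h3 := (hE t₀ ht₀ (q t₀) (v t₀) (hJ t₀ (mem_Ici.2 le_rfl))).2
    have h4 : taskError rob des t₀ (q t₀) (v t₀) ^ 2 ≤ c₁ / c₂ * (s / cz) ^ 2 := by
      rw [← Real.sq_sqrt (by positivity : 0 ≤ c₁ / c₂), ← mul_pow]
      have := taskError_nonneg rob des t₀ (q t₀) (v t₀)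
      gcongr
    have h5 : c₁ * taskError rob des t (q t) (v t) ^ 2 ≤ c₁ * (s / cz) ^ 2 := by
      calc _ ≤ c₂ * taskError rob des t₀ (q t₀) (v t₀) ^ 2 := h1.trans (h2.trans h3)
        _ ≤ c₂ * (c₁ / c₂ * (s / cz) ^ 2) := by gcongr
        _ = c₁ * (s / cz) ^ 2 := by field_simp
    exact le_of_sq_le_sq (le_of_mul_le_mul_left h5 hc₁) (by positivity)
  set e : ℝ → Six → ℝ := fun t => velError rob des t (q t) (v t) with he
  set Q : ℝ → Matrix (Fin 3) (Fin 3) ℝ := fun t => relRot (rob.fk (q t)) (des.g t) with hQ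
  set r : ℝ → Fin 3 → ℝ := fun t => relPos (rob.fk (q t)) (des.g t) with hr
  set f : ℝ → Six → ℝ := fun t => force Kp KR (Q t) (r t) with hf
  have hQmem : ∀ t ∈ Ici t₀, Q t ∈ Matrix.specialOrthogonalGroup (Fin 3) ℝ := fun t ht =>
    relRot_mem (rob.rot _) (des.rot t (hS ht))
  have hzs : ∀ t ∈ Ici t₀, ‖(1 - Q t, r t)‖ ≤ s := fun t ht => by
    have h1 := (hz (rob.fk (q t)) (des.g t) (des.rot t (hS ht))).2
    have h2 := hsmall t ht
    rw [taskError_eq] at h2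
    have h3 := norm_nonneg (velError rob des t (q t) (v t))
    calc _ ≤ cz * poseError (rob.fk (q t)) (des.g t) := h1
      _ ≤ cz * (s / cz) := by gcongr; linarith
      _ = s := by field_simp
  have hes : ∀ t ∈ Ici t₀, ‖e t‖ ≤ s / cz := fun t ht => by
    have h2 := hsmall t ht
    rw [taskError_eq] at h2
    have h3 := poseError_nonneg (rob.fk (q t)) (des.g t)
    linarith
  have hrs : ∀ t ∈ Ici t₀, ‖r t‖ ≤ s := fun t ht => (norm_snd_le (1 - Q t, r t)).trans (hzs t ht)
  have hvs : ∀ t ∈ Ici t₀, ‖v t‖ ≤ cJ * (s / cz + cA * B) := fun t ht => by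
    have h1 : v t = (rob.J (q t))⁻¹ *ᵥ (e t + VdStar (rob.fk (q t)) (des.g t) (des.V t)) := by
      simp only [he, velError]
      rw [sub_add_cancel, Matrix.mulVec_mulVec, Matrix.nonsing_inv_mul _
        (isUnit_iff_ne_zero.2 (hmot.nonsingular t ht)), Matrix.one_mulVec]
    have h2 := hVd (rob.fk (q t)) (des.g t) (rob.rot _) (des.rot t (hS ht)) (hrs t ht) (des.V t)
    have h3 := hB t (hS ht)
    rw [h1]
    refine (hJinv _ (hJ t ht) _).trans ?_
    gcongr
    refine (norm_add_le _ _).trans (add_le_add (hes t ht) (h2.trans ?_))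
    gcongr
  have hfz : ∀ t ∈ Ici t₀, ‖(1 - Q t, r t)‖ ≤ cs * ‖f t‖ := fun t ht =>
    hforce' _ (hQmem t ht) _ ((norm_fst_le (1 - Q t, r t)).trans (hzs t ht))
  have hVto : Tendsto (fun t => energy rob des Kp KR t (q t) (v t)) atTop (𝓝 0) := by
    have hu := fun t (ht : t ∈ Ici t₀) => uniqueDiffOn_Ici t₀ t ht
    -- Each `6` is the dimension factor of `abs_dotProduct_le`. The last constant bounds the kinetic
    -- part by `‖e‖²`, and the potential by `‖f‖²` through `exists_norm_le_force`.
    refine tendsto_zero_of_cross_term (t₀ := t₀) (k := k) (c := 6 * cF + 6 * cL) (ν := ν)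
      (c₁ := 6 * (cf / p₁ + cf / k₁)) (c₂ := k₂ + p₂ * cs ^ 2)
      (X := fun t => f t ⬝ᵥ e t) (a := fun t => ‖e t‖) (b := fun t => ‖f t‖)
      hk (by positivity) hν (by positivity) (by positivity)
      (fun t ht => hmot.hasDerivWithinAt_energy (transpose_eq_of_posDef hKp)
        (transpose_eq_of_posDef hKR) hS ht (hu t ht))
      (fun t ht => hasDerivWithinAt_dotProduct (hasDerivWithinAt_force Kp KR
        (matHasDerivWithinAt_relRot_velError hS ht (hmot.vel t ht))
        (hasDerivWithinAt_relPos_velError hS ht (hmot.vel t ht)))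
        (hmot.hasDerivWithinAt_velError hS ht (hu t ht)))
      (fun t ht => ?_) (fun t ht => ?_) (fun t ht => ?_) (fun t ht => ?_)
    · have := hKd' () rfl (e t)
      simp only [he] at this ⊢
      linarith
    · have h1 := (le_abs_self _).trans (abs_dotProduct_le (forceDeriv Kp KR (Q t) (r t) (e t)) (e t))
      have h2 := hF (Q t) (hQmem t ht) (r t) (hrs t ht) (e t)
      have h3 := (le_abs_self _).trans
        (abs_dotProduct_le (f t) (errorDrift rob Kd (q t) (v t) (e t)))
      have h4 := hL (q t) (hJ t ht) (v t) (hvs t ht) (e t)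
      have h5 := hN (q t) (hJ t ht) (f t)
      have hcard : (Fintype.card Six : ℝ) = 6 := by simp
      rw [hcard] at h1 h3
      rw [dotProduct_sub]
      have h6 : 6 * ‖forceDeriv Kp KR (Q t) (r t) (e t)‖ * ‖e t‖ ≤ 6 * (cF * ‖e t‖) * ‖e t‖ := by
        gcongr
      have h7 : 6 * ‖f t‖ * ‖errorDrift rob Kd (q t) (v t) (e t)‖ ≤ 6 * ‖f t‖ * (cL * ‖e t‖) := by
        gcongr
      have h8 : 0 ≤ cL * ‖e t‖ ^ 2 := by positivity
      have h9 : 0 ≤ cF * (‖e t‖ * ‖f t‖) := by positivity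
      change forceDeriv Kp KR (Q t) (r t) (e t) ⬝ᵥ e t +
        (f t ⬝ᵥ errorDrift rob Kd (q t) (v t) (e t) - f t ⬝ᵥ (rob.J (q t) *ᵥ ((rob.M (q t))⁻¹ *ᵥ
          ((rob.J (q t))ᵀ *ᵥ f t)))) ≤ _
      linarith
    · have h1 := abs_dotProduct_le (f t) (e t)
      have hcard : (Fintype.card Six : ℝ) = 6 := by simp
      rw [hcard] at h1
      have h2 := hforce (Q t) (hQmem t ht) (r t)
      have h3 := (hP (Q t) (hQmem t ht) (r t)).1
      have h4 := (hK (q t) (hJ t ht) (e t)).1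
      set z := ‖(1 - Q t, r t)‖
      have hz0 : 0 ≤ z := norm_nonneg _
      have hen : energy rob des Kp KR t (q t) (v t) = (1 / 2) * (((rob.J (q t))⁻¹ *ᵥ e t) ⬝ᵥ
        (rob.M (q t) *ᵥ ((rob.J (q t))⁻¹ *ᵥ e t))) + potential Kp KR (Q t) (r t) := rfl
      set kin := (1 / 2) * (((rob.J (q t))⁻¹ *ᵥ e t) ⬝ᵥ (rob.M (q t) *ᵥ ((rob.J (q t))⁻¹ *ᵥ e t)))
      set pot := potential Kp KR (Q t) (r t)
      have h5 : 6 * ‖f t‖ * ‖e t‖ ≤ 6 * (cf * z) * ‖e t‖ := by gcongr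
      have h6 : z * ‖e t‖ ≤ z ^ 2 + ‖e t‖ ^ 2 := by
        nlinarith [sq_nonneg (z - ‖e t‖), sq_nonneg (z + ‖e t‖)]
      have h7 : z ^ 2 ≤ pot / p₁ := by rw [le_div_iff₀ hp₁]; linarith
      have h8 : ‖e t‖ ^ 2 ≤ kin / k₁ := by rw [le_div_iff₀ hk₁]; linarith
      have h9 : 0 ≤ pot := le_trans (by positivity) h3
      have h10 : 0 ≤ kin := le_trans (by positivity) h4
      have h11 : 0 ≤ cf / p₁ * kin := by positivity
      have h12 : 0 ≤ cf / k₁ * pot := by positivity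
      rw [hen]
      calc |f t ⬝ᵥ e t| ≤ 6 * cf * (z * ‖e t‖) := by linarith
        _ ≤ 6 * cf * (pot / p₁ + kin / k₁) := by gcongr; linarith
        _ = 6 * (cf / p₁ * pot + cf / k₁ * kin) := by ring
        _ ≤ 6 * (cf / p₁ + cf / k₁) * (kin + pot) := by linarith
    · have h1 := (hP (Q t) (hQmem t ht) (r t)).2
      have h2 := (hK (q t) (hJ t ht) (e t)).2
      have h3 := hfz t ht
      have hen : energy rob des Kp KR t (q t) (v t) = (1 / 2) * (((rob.J (q t))⁻¹ *ᵥ e t) ⬝ᵥ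
        (rob.M (q t) *ᵥ ((rob.J (q t))⁻¹ *ᵥ e t))) + potential Kp KR (Q t) (r t) := rfl
      have h4 : ‖(1 - Q t, r t)‖ ^ 2 ≤ cs ^ 2 * ‖f t‖ ^ 2 := by rw [← mul_pow]; gcongr
      have h5 := mul_le_mul_of_nonneg_left h4 hp₂.le
      have h6 : 0 ≤ k₂ * ‖f t‖ ^ 2 := by positivity
      have h7 : 0 ≤ p₂ * cs ^ 2 * ‖e t‖ ^ 2 := by positivity
      rw [hen]
      linarith
  have hsq : Tendsto (fun t => Real.sqrt (energy rob des Kp KR t (q t) (v t) / c₁)) atTop (𝓝 0) := by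
    simpa using (hVto.div_const c₁).sqrt
  refine squeeze_zero' (Eventually.of_forall fun t => taskError_nonneg rob des t (q t) (v t))
    (eventually_atTop.2 ⟨t₀, fun t ht => ?_⟩) hsq
  refine Real.le_sqrt_of_sq_le ?_
  rw [le_div_iff₀ hc₁, mul_comm]
  exact (hE t (hS ht) (q t) (v t) (hJ t ht)).1

end Convergence

/-! ### Local injectivity of the forward kinematics, uniformly on the torus -/

section LocalInjectivity

variable (rob : Manipulator)

/-- Forward kinematics as a map into a normed space. -/
def Manipulator.fkPair (q : Six → ℝ) : (Fin 3 → Fin 3 → ℝ) × (Fin 3 → ℝ) :=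
  (fun i j => (rob.fk q).R i j, (rob.fk q).p)

theorem norm_fkPair_sub_le (q q₀ : Six → ℝ) :
    ‖rob.fkPair q - rob.fkPair q₀‖ ≤ poseError (rob.fk q) (rob.fk q₀) := by
  have h := norm_le_poseError (rob.fk q) (rob.fk q₀)
  rw [Prod.norm_def] at h ⊢
  refine le_trans (le_of_eq ?_) h
  congr 1
  exact norm_sub_rev (E := Fin 3 → Fin 3 → ℝ) _ _

theorem contDiff_fkPair : ContDiff ℝ 1 rob.fkPair :=
  (contDiff_pi.2 fun i => contDiff_pi.2 fun j => (rob.smooth_R i j).of_le one_le_two).prodMk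
    (contDiff_pi.2 fun i => (rob.smooth_p i).of_le one_le_two)

theorem fderiv_fkPair (q w : Six → ℝ) :
    fderiv ℝ rob.fkPair q w = (fun i j => rob.rotDeriv q w i j, rob.posDeriv q w) := by
  have h : HasDerivWithinAt (fun s : ℝ => q + s • w) w univ 0 := by
    have := ((hasDerivAt_id (0 : ℝ)).smul_const w).const_add q
    simpa using this
  have h0 : q + (0 : ℝ) • w = q := by simp
  have hd : DifferentiableAt ℝ rob.fkPair (q + (0 : ℝ) • w) :=
    (contDiff_fkPair rob).differentiable one_ne_zero _
  have h1 := hd.hasFDerivAt.comp_hasDerivWithinAt 0 h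
  have h2 : HasDerivWithinAt (fun s : ℝ => rob.fkPair (q + s • w))
      ((fun i j => rob.rotDeriv (q + (0 : ℝ) • w) w i j), rob.posDeriv (q + (0 : ℝ) • w) w)
      univ 0 :=
    (hasDerivWithinAt_pi.2 fun i => hasDerivWithinAt_pi.2 fun j =>
      rob.matHasDerivWithinAt_R h i j).prodMk (rob.hasDerivWithinAt_p h)
  have h3 := uniqueDiffWithinAt_univ.eq_deriv _ h1 h2
  rwa [h0] at h3

theorem fderiv_fkPair_injective {q : Six → ℝ} (hq : (rob.J q).det ≠ 0) :
    Function.Injective (fderiv ℝ rob.fkPair q) := by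
  rw [injective_iff_map_eq_zero]
  intro w hw
  rw [fderiv_fkPair, Prod.mk_eq_zero] at hw
  have hR : rob.rotDeriv q w = 0 := hw.1
  have hJ : rob.J q *ᵥ w = 0 := by
    rw [rob.J_mulVec, hR, hw.2]
    ext (i | i)
    · simp
    · fin_cases i <;> simp [vee]
  rw [← Matrix.one_mulVec w, ← Matrix.nonsing_inv_mul _ (isUnit_iff_ne_zero.2 hq),
    ← Matrix.mulVec_mulVec, hJ, Matrix.mulVec_zero]

/-- The derivative is injective, hence bounded below, and strict differentiability makes the error
at most half of that lower bound. Both points vary, which is what permits a bound uniform in the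
base point. -/
theorem exists_local_bound {q₀ : Six → ℝ} (hq₀ : (rob.J q₀).det ≠ 0) :
    ∃ c, 0 < c ∧ ∀ᶠ x in 𝓝 (q₀, q₀), c * ‖x.1 - x.2‖ ≤ ‖rob.fkPair x.1 - rob.fkPair x.2‖ := by
  obtain ⟨c, hc, H⟩ := exists_le_of_homogeneous (isCompact_singleton (x := ()))
    (fun _ (w : Six → ℝ) => ‖fderiv ℝ rob.fkPair q₀ w‖ ^ 2)
    (by simp only [Function.uncurry_def]; fun_prop)
    (fun _ t w => by simp [norm_smul, mul_pow])
    (fun _ _ w hw => by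
      have := (map_ne_zero_iff _ (fderiv_fkPair_injective rob hq₀)).2 hw
      positivity)
  have hlow : ∀ w, Real.sqrt c * ‖w‖ ≤ ‖fderiv ℝ rob.fkPair q₀ w‖ := fun w => by
    refine le_of_sq_le_sq ?_ (norm_nonneg _)
    rw [mul_pow, Real.sq_sqrt hc.le]
    exact H () rfl w
  have hs : HasStrictFDerivAt rob.fkPair (fderiv ℝ rob.fkPair q₀) q₀ :=
    (contDiff_fkPair rob).contDiffAt.hasStrictFDerivAt one_ne_zero
  have hsc : 0 < Real.sqrt c := Real.sqrt_pos.2 hc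
  refine ⟨Real.sqrt c / 2, by positivity, ?_⟩
  filter_upwards [hs.isLittleO.def (half_pos hsc)] with x hx
  have h1 := hlow (x.1 - x.2)
  have h2 := norm_sub_norm_le (fderiv ℝ rob.fkPair q₀ (x.1 - x.2))
    (rob.fkPair x.1 - rob.fkPair x.2)
  rw [norm_sub_rev _ (rob.fkPair x.1 - rob.fkPair x.2)] at h2
  linarith

/-- Local bounds are combined by compactness of the nonsingular part of one period box, and
periodicity carries them to all base points. -/
theorem exists_uniform_local_bound {σ : ℝ} (hσ : 0 < σ) : ∃ η c : ℝ, 0 < η ∧ 0 < c ∧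
    ∀ q₀, σ ≤ |(rob.J q₀).det| → ∀ q, ‖q - q₀‖ < η →
      c * ‖q - q₀‖ ≤ poseError (rob.fk q) (rob.fk q₀) ∧ σ / 2 ≤ |(rob.J q).det| := by
  have hcpt : ∃ η c : ℝ, 0 < η ∧ 0 < c ∧
      ∀ q₀ ∈ {q ∈ Icc (0 : Six → ℝ) (fun _ => 2 * Real.pi) | σ ≤ |(rob.J q).det|},
      ∀ q, ‖q - q₀‖ < η →
      c * ‖q - q₀‖ ≤ poseError (rob.fk q) (rob.fk q₀) ∧ σ / 2 ≤ |(rob.J q).det| := by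
    refine (rob.isCompact_nonsingular σ).induction_on (p := fun s => ∃ η c : ℝ, 0 < η ∧ 0 < c ∧
      ∀ q₀ ∈ s, ∀ q, ‖q - q₀‖ < η →
      c * ‖q - q₀‖ ≤ poseError (rob.fk q) (rob.fk q₀) ∧ σ / 2 ≤ |(rob.J q).det|) ?_ ?_ ?_ ?_
    · exact ⟨1, 1, one_pos, one_pos, by simp⟩
    · rintro s t hst ⟨η, c, hη, hc, H⟩
      exact ⟨η, c, hη, hc, fun q₀ hq₀ => H q₀ (hst hq₀)⟩
    · rintro s t ⟨η, c, hη, hc, H⟩ ⟨η', c', hη', hc', H'⟩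
      refine ⟨min η η', min c c', by positivity, by positivity, ?_⟩
      rintro q₀ (hq₀ | hq₀) q hq
      · obtain ⟨h1, h2⟩ := H q₀ hq₀ q (hq.trans_le (min_le_left _ _))
        exact ⟨le_trans (by gcongr; exact min_le_left _ _) h1, h2⟩
      · obtain ⟨h1, h2⟩ := H' q₀ hq₀ q (hq.trans_le (min_le_right _ _))
        exact ⟨le_trans (by gcongr; exact min_le_right _ _) h1, h2⟩
    · rintro x ⟨-, hx⟩
      have hd : (rob.J x).det ≠ 0 := fun h0 => by
        rw [h0, abs_zero] at hx
        exact absurd hx (not_le.2 hσ)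
      obtain ⟨c, hc, h1⟩ := exists_local_bound rob hd
      have h2 : ∀ᶠ q in 𝓝 x, σ / 2 < |(rob.J q).det| :=
        rob.continuous_J.matrix_det.abs.continuousAt.eventually
          (lt_mem_nhds (by linarith : σ / 2 < |(rob.J x).det|))
      rw [nhds_prod_eq] at h1
      obtain ⟨U, hU, V, hV, hUV⟩ := mem_prod_iff.1 h1
      obtain ⟨η, hη, hball⟩ := Metric.mem_nhds_iff.1 (inter_mem (inter_mem hU hV) h2)
      -- Halving the radius puts both `q₀` and every `q` within `η / 2` of it into the ball where
      -- the estimates hold.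
      refine ⟨Metric.ball x (η / 2), mem_nhdsWithin_of_mem_nhds
        (Metric.ball_mem_nhds x (half_pos hη)), η / 2, c, half_pos hη, hc, fun q₀ hq₀ q hq => ?_⟩
      have m0 := hball (Metric.ball_subset_ball (half_le_self hη.le) hq₀)
      have m1 := hball (a := q) (by
        rw [Metric.mem_ball] at hq₀ ⊢
        rw [← dist_eq_norm] at hq
        linarith [dist_triangle q q₀ x])
      exact ⟨(hUV (mk_mem_prod m1.1.1 m0.1.2)).trans (norm_fkPair_sub_le rob q q₀), m1.2.le⟩
  obtain ⟨η, c, hη, hc, H⟩ := hcpt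
  refine ⟨η, c, hη, hc, fun q₀ hq₀ q hq => ?_⟩
  -- The period that brings `q₀` into the box is added to both points, so their difference is
  -- unchanged; `q` itself may leave the box.
  obtain ⟨d, hd, hper⟩ := exists_period_add_mem_Icc q₀
  have hJ := hper rob.J rob.periodic_J
  have hfk := hper rob.fk (fun i q => rob.periodic_fk q i)
  have h := H (q₀ + d) ⟨hd, by rwa [hJ q₀]⟩ (q + d) (by simpa using hq)
  rwa [hJ q, hfk q, hfk q₀, add_sub_add_right_eq_sub] at h

end LocalInjectivity

end Norms

/-! ### Stability -/

section Stability

variable {rob : Manipulator} {des : DesiredTrajectory} {Kp KR : Matrix (Fin 3) (Fin 3) ℝ}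
  {Kd : Matrix Six Six ℝ}

/-- Energy monotonicity does not involve `ρ`, so the determinant bound is required only at the two
times compared. The continuity argument for the joint angles relies on this. -/
theorem exists_taskError_le (rob : Manipulator) (des : DesiredTrajectory) (hKp : Kp.PosDef)
    (hKR : KR.PosDef) (hKd : Kd.PosDef) {ρ : ℝ} (hρ : 0 < ρ) : ∃ c : ℝ, 0 < c ∧
    ∀ (S : Set ℝ) (q v a : ℝ → Six → ℝ), IsClosedLoopMotion rob des Kp KR Kd S q v a →
      S ⊆ Ici 0 → S.OrdConnected → UniqueDiffOn ℝ S → ∀ t₀ ∈ S, ∀ t ∈ S, t₀ ≤ t →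
      ρ ≤ |(rob.J (q t₀)).det| → ρ ≤ |(rob.J (q t)).det| →
      taskError rob des t (q t) (v t) ≤ c * taskError rob des t₀ (q t₀) (v t₀) := by
  obtain ⟨c₁, c₂, hc₁, hc₂, hE⟩ := exists_energy_bounds rob hKp hKR des hρ
  refine ⟨Real.sqrt (c₂ / c₁), by positivity,
    fun S q v a hmot hS hSc hu t₀ ht₀ t ht hle hJ₀ hJ => ?_⟩
  have h1 := (hE t (hS ht) (q t) (v t) hJ).1
  have h2 := hmot.energy_le hKp hKR hKd hS hSc hu ht₀ ht hle
  have h3 := (hE t₀ (hS ht₀) (q t₀) (v t₀) hJ₀).2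
  have h0 := taskError_nonneg rob des t₀ (q t₀) (v t₀)
  refine le_of_sq_le_sq ?_ (by positivity)
  rw [mul_pow, Real.sq_sqrt (by positivity), div_mul_eq_mul_div, le_div_iff₀ hc₁]
  linarith

theorem asymptoticallyStable_taskError (rob : Manipulator) (des : DesiredTrajectory)
    (hKp : Kp.PosDef) (hKR : KR.PosDef) (hKd : Kd.PosDef)
    {B : ℝ} (hB : ∀ t, 0 ≤ t → ‖des.V t‖ ≤ B) {ρ : ℝ} (hρ : 0 < ρ) :
    AsymptoticallyStable
      (fun S q v => (∃ a, IsClosedLoopMotion rob des Kp KR Kd S q v a) ∧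
        ∀ t ∈ S, ρ ≤ |(rob.J (q t)).det|) (taskError rob des) := by
  obtain ⟨c, hc, H⟩ := exists_taskError_le rob des hKp hKR hKd hρ
  refine ⟨fun ε hε => ⟨ε / c, by positivity, ?_⟩, ?_⟩
  · rintro t₀ ht₀ T q v ⟨⟨a, hmot⟩, hJ⟩ hinit t ht
    have ht₀' : t₀ ∈ Ico t₀ T := ⟨le_rfl, ht.1.trans_lt ht.2⟩
    have h := H (Ico t₀ T) q v a hmot (fun s hs => ht₀.trans hs.1) ordConnected_Ico
      (uniqueDiffOn_Ico t₀ T) t₀ ht₀' t ht ht.1 (hJ _ ht₀') (hJ _ ht)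
    rw [lt_div_iff₀' hc] at hinit
    exact h.trans_lt hinit
  · obtain ⟨δ, hδ, h⟩ := exists_tendsto_taskError rob des hKp hKR hKd hB hρ
    exact ⟨δ, hδ, fun t₀ ht₀ q v ⟨⟨a, hmot⟩, hJ⟩ hinit => h t₀ ht₀ q v a hmot hJ hinit⟩

/-- A continuous nonnegative quantity that starts below `η / 2` and is below `η / 2` whenever it is
below `η` stays below `η / 2`. -/
theorem lt_half_of_bootstrap {S : Set ℝ} (hSc : S.OrdConnected) {φ : ℝ → ℝ}
    (hφ : ContinuousOn φ S) {η t₀ : ℝ} (hη : 0 < η) (ht₀ : t₀ ∈ S) (h0 : φ t₀ < η / 2)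
    (hstep : ∀ t ∈ S, t₀ ≤ t → φ t < η → φ t < η / 2) {t : ℝ} (ht : t ∈ S) (hle : t₀ ≤ t) :
    φ t < η / 2 := by
  by_contra! hge
  obtain ⟨s, hs, hsv⟩ := intermediate_value_Icc hle (hφ.mono (hSc.out ht₀ ht)) ⟨h0.le, hge⟩
  have := hstep s (hSc.out ht₀ ht hs) hs.1 (by linarith)
  linarith

theorem exists_stateError_le (rob : Manipulator) (des : DesiredTrajectory) (hKp : Kp.PosDef)
    (hKR : KR.PosDef) (hKd : Kd.PosDef) {qd : ℝ → Six → ℝ}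
    (hreach : ∀ t, 0 ≤ t → rob.fk (qd t) = des.g t) (hqd : ContinuousOn qd (Ici 0))
    {σ : ℝ} (hσ : 0 < σ) (hsing : ∀ t, 0 ≤ t → σ ≤ |(rob.J (qd t)).det|) :
    ∃ δ c c' : ℝ, 0 < δ ∧ 0 < c ∧ 0 < c' ∧
    ∀ (S : Set ℝ) (q v a : ℝ → Six → ℝ), IsClosedLoopMotion rob des Kp KR Kd S q v a →
      S ⊆ Ici 0 → S.OrdConnected → UniqueDiffOn ℝ S → ∀ t₀ ∈ S,
      stateError rob des qd t₀ (q t₀) (v t₀) < δ → ∀ t ∈ S, t₀ ≤ t →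
      σ / 2 ≤ |(rob.J (q t)).det| ∧
      stateError rob des qd t (q t) (v t) ≤ c' * taskError rob des t (q t) (v t) ∧
      stateError rob des qd t (q t) (v t) ≤ c * stateError rob des qd t₀ (q t₀) (v t₀) := by
  obtain ⟨η, k, hη, hk, hloc⟩ := exists_uniform_local_bound rob hσ
  obtain ⟨C, hC, hle⟩ := exists_taskError_le rob des hKp hKR hKd (half_pos hσ)
  -- The first bound starts the joint deviation below `η / 2`. The second makes the propagated task
  -- error less than `k η / 2`, so that local injectivity returns a deviation below `η / 2`.
  refine ⟨min (η / 2) (η / 2 * k / C), (1 / k + 1) * C, 1 / k + 1, by positivity, by positivity,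
    by positivity, ?_⟩
  intro S q v a hmot hS hSc hu t₀ ht₀ hinit
  have hφ₀ : ‖q t₀ - qd t₀‖ < η / 2 := by
    have h1 := hinit.trans_le (min_le_left _ _)
    rw [stateError] at h1
    linarith [taskError_nonneg rob des t₀ (q t₀) (v t₀)]
  have hτ₀ : taskError rob des t₀ (q t₀) (v t₀) < η / 2 * k / C := by
    have h1 := hinit.trans_le (min_le_right _ _)
    rw [stateError] at h1
    linarith [norm_nonneg (q t₀ - qd t₀)]
  have hnear : ∀ t ∈ S, ‖q t - qd t‖ < η → k * ‖q t - qd t‖ ≤ taskError rob des t (q t) (v t) ∧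
      σ / 2 ≤ |(rob.J (q t)).det| := fun t ht h => by
    obtain ⟨h1, h2⟩ := hloc (qd t) (hsing t (hS ht)) (q t) h
    rw [hreach t (hS ht)] at h1
    rw [taskError_eq]
    exact ⟨by linarith [norm_nonneg (velError rob des t (q t) (v t))], h2⟩
  have hJ₀ := (hnear t₀ ht₀ (by linarith)).2
  have hcont : ContinuousOn (fun t => ‖q t - qd t‖) S :=
    (ContinuousOn.sub (fun t ht => (hmot.vel t ht).continuousWithinAt) (hqd.mono hS)).norm
  -- A deviation below `η` gives the determinant bound, hence the task error estimate, hence a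
  -- deviation below `η / 2`. By continuity the gap between `η / 2` and `η` is never entered.
  have hstay : ∀ t ∈ S, t₀ ≤ t → ‖q t - qd t‖ < η / 2 := fun t ht htt =>
    lt_half_of_bootstrap hSc hcont hη ht₀ hφ₀ (fun s hs hss hlt => by
      obtain ⟨h1, h2⟩ := hnear s hs hlt
      have h3 := hle S q v a hmot hS hSc hu t₀ ht₀ s hs hss hJ₀ h2
      rw [lt_div_iff₀' hC] at hτ₀
      have h4 : k * ‖q s - qd s‖ < k * (η / 2) := by linarith
      exact lt_of_mul_lt_mul_left h4 hk.le) ht htt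
  intro t ht htt
  obtain ⟨h1, h2⟩ := hnear t ht (by linarith [hstay t ht htt])
  have h3 := hle S q v a hmot hS hSc hu t₀ ht₀ t ht htt hJ₀ h2
  have h4 : stateError rob des qd t (q t) (v t) ≤
      (1 / k + 1) * taskError rob des t (q t) (v t) := by
    rw [stateError, add_mul, one_mul, one_div_mul_eq_div]
    gcongr
    rwa [le_div_iff₀' hk]
  refine ⟨h2, h4, h4.trans ?_⟩
  rw [mul_assoc]
  gcongr
  refine h3.trans ?_
  gcongr
  rw [stateError]
  linarith [norm_nonneg (q t₀ - qd t₀)]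

theorem asymptoticallyStable_stateError (rob : Manipulator) (des : DesiredTrajectory)
    (hKp : Kp.PosDef) (hKR : KR.PosDef) (hKd : Kd.PosDef) {qd : ℝ → Six → ℝ}
    (hreach : ∀ t, 0 ≤ t → rob.fk (qd t) = des.g t) (hqd : ContinuousOn qd (Ici 0))
    {σ : ℝ} (hσ : 0 < σ) (hsing : ∀ t, 0 ≤ t → σ ≤ |(rob.J (qd t)).det|)
    {B : ℝ} (hB : ∀ t, 0 ≤ t → ‖des.V t‖ ≤ B) :
    AsymptoticallyStable (fun S q v => ∃ a, IsClosedLoopMotion rob des Kp KR Kd S q v a)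
      (stateError rob des qd) := by
  obtain ⟨δ, c, c', hδ, hc, hc', H⟩ :=
    exists_stateError_le rob des hKp hKR hKd hreach hqd hσ hsing
  refine ⟨fun ε hε => ⟨min δ (ε / c), by positivity, ?_⟩, ?_⟩
  · rintro t₀ ht₀ T q v ⟨a, hmot⟩ hinit t ht
    have h := (H (Ico t₀ T) q v a hmot (fun s hs => ht₀.trans hs.1) ordConnected_Ico
      (uniqueDiffOn_Ico t₀ T) t₀ ⟨le_rfl, ht.1.trans_lt ht.2⟩ (hinit.trans_le (min_le_left _ _))
      t ht ht.1).2.2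
    have h1 := hinit.trans_le (min_le_right _ _)
    rw [lt_div_iff₀' hc] at h1
    exact h.trans_lt h1
  -- The state error estimate keeps `|det J| ≥ σ / 2` along the whole motion, so convergence of the
  -- task error applies with that bound, and the task error dominates the joint deviation.
  · obtain ⟨δ', hδ', h'⟩ := exists_tendsto_taskError rob des hKp hKR hKd hB (half_pos hσ)
    refine ⟨min δ δ', by positivity, ?_⟩
    rintro t₀ ht₀ q v ⟨a, hmot⟩ hinit
    have h := H (Ici t₀) q v a hmot (Ici_subset_Ici.2 ht₀) ordConnected_Ici
      (uniqueDiffOn_Ici t₀) t₀ (mem_Ici.2 le_rfl) (hinit.trans_le (min_le_left _ _))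
    have hlim := h' t₀ ht₀ q v a hmot (fun t ht => (h t ht ht).1) (by
      have := hinit.trans_le (min_le_right _ _)
      rw [stateError] at this
      linarith [norm_nonneg (q t₀ - qd t₀)])
    refine squeeze_zero' (Eventually.of_forall fun t =>
      add_nonneg (norm_nonneg _) (taskError_nonneg rob des t (q t) (v t)))
      (eventually_atTop.2 ⟨t₀, fun t ht => (h t ht ht).2.1⟩) (by simpa using hlim.const_mul c')

end Stability

end GeomImpedance

theorem theorem2
    (rob : GeomImpedance.Manipulator) (des : GeomImpedance.DesiredTrajectory)
    (Kp KR : Matrix (Fin 3) (Fin 3) ℝ)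
    (Kd : Matrix GeomImpedance.Six GeomImpedance.Six ℝ)
    (hKp : Kp.PosDef) (hKR : KR.PosDef) (hKd : Kd.PosDef)
    (qd vd ad : ℝ → (GeomImpedance.Six → ℝ))
    (hreach : ∀ t, 0 ≤ t → rob.fk (qd t) = des.g t)
    (hqd : ∀ t, 0 ≤ t → HasDerivWithinAt qd (vd t) (Set.Ici 0) t)
    (hvd : ∀ t, 0 ≤ t → HasDerivWithinAt vd (ad t) (Set.Ici 0) t)
    (σ : ℝ) (hσ : 0 < σ) (hsing : ∀ t, 0 ≤ t → σ ≤ |(rob.J (qd t)).det|)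
    (B : ℝ) (hB : ∀ t, 0 ≤ t → ‖des.V t‖ ≤ B) :
    -- the desired motion is a motion of the closed loop with zero error and zero elastic force
    (GeomImpedance.IsClosedLoopMotion rob des Kp KR Kd (Set.Ici 0) qd vd ad ∧
      ∀ t, 0 ≤ t → GeomImpedance.taskError rob des t (qd t) (vd t) = 0 ∧
        GeomImpedance.elasticForce Kp KR (rob.fk (qd t)) (des.g t) = 0) ∧
    -- it is asymptotically stable in the joint state space
    GeomImpedance.AsymptoticallyStable
      (fun S q v => ∃ a, GeomImpedance.IsClosedLoopMotion rob des Kp KR Kd S q v a)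
      (GeomImpedance.stateError rob des qd) ∧
    -- in terms of the end-effector alone, `g = g_d` is asymptotically stable among all motions
    -- (on any branch of the inverse kinematics) that stay away from singular configurations
    (∀ ρ : ℝ, 0 < ρ → GeomImpedance.AsymptoticallyStable
      (fun S q v => (∃ a, GeomImpedance.IsClosedLoopMotion rob des Kp KR Kd S q v a) ∧
        ∀ t ∈ S, ρ ≤ |(rob.J (q t)).det|)
      (GeomImpedance.taskError rob des)) := by
  have hdet : ∀ t, 0 ≤ t → (rob.J (qd t)).det ≠ 0 := fun t ht h0 => by
    have := hsing t ht
    rw [h0, abs_zero] at this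
    exact absurd this (not_le.2 hσ)
  exact ⟨GeomImpedance.isClosedLoopMotion_of_reach hreach hqd hvd hdet,
    GeomImpedance.asymptoticallyStable_stateError rob des hKp hKR hKd hreach
      (fun t ht => (hqd t ht).continuousWithinAt) hσ hsing hB,
    fun _ hρ => GeomImpedance.asymptoticallyStable_taskError rob des hKp hKR hKd hB hρ⟩
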